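/- Let $\Bbbk$ be a field, $n\ge 1$, and let $S=\Bbbk[X_{i,j}]_{1\le i,j\le n}$ act on $R=\Bbbk[x_{i,j}]_{1\le i,j\le n}$ by contraction: for monomials, $X^{s}\star x^{t}=x^{t-s}$ if $t-s$ has no negative entry, and $X^s\star x^t=0$ otherwise. For $f\in R$ let $f^\perp=\{g\in S: g\star f=0\}$ be its apolar ideal, and let $\det_n,\operatorname{perm}_n\in R$ be the generic determinant and permanent. Let $F_1$ be the free $S$-module with one basis element $(g)$ for each of the quadrics $$X_{i,j}^2,\qquad X_{i,j}X_{i,l}\ (j<l),\qquad X_{i,j}X_{m,j}\ (i<m),\qquad X_{i,j}X_{m,l}-X_{i,l}X_{m,j}\ (i<m,\ j<l),$$ with the conventions that $(X_{i,j}X_{i,l})$ and $(X_{i,j}X_{m,j})$ do not depend on the order of the factors and that $(-g)=-(g)$, and let $d\colon F_1\to S$ be the $S$-linear map with $(g)\mapsto g$. A relation is an element of $\ker d$. The symmetries "permute the rows, permute the columns, transpose" of the matrix $(X_{i,j})$ act on $F_1$ by acting simultaneously on coefficients and on generators. Consider the elements of $F_1$ $$\begin{aligned} \rho_1' &= X_{1,2}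 (X_{1,1}^2) - X_{1,1} (X_{1,1} X_{1,2}),\\ \rho_2' &= X_{1,3} (X_{1,1} X_{1,2}) - X_{1,2} (X_{1,1} X_{1,3}),\\ \rho_3' &= X_{2,1} (X_{1,1} X_{1,2}) - X_{1,2} (X_{1,1} X_{2,1}),\\ \rho_4' &= X_{1,1} (X_{1,1} X_{2,2} - X_{1,2} X_{2,1}) + X_{2,1} (X_{1,1} X_{1,2}) - X_{2,2} (X_{1,1}^2),\\ \rho_5' &= X_{1,3} (X_{1,1} X_{2,2} - X_{1,2} X_{2,1}) - X_{2,2} (X_{1,1} X_{1,3}) + X_{2,1} (X_{1,2} X_{1,3}),\\ \rho_S' &= X_{3,3} (X_{1,1} X_{2,2} - X_{1,2} X_{2,1}) - X_{1,2} (X_{2,3} X_{3,1} - X_{2,1} X_{3,3})\\ &\quad + X_{2,3} (X_{1,2} X_{3,1} - X_{1,1} X_{3,2}) - X_{1,1} (X_{2,2} X_{3,3} - X_{2,3} X_{3,2}),\\ \rho_Q' &= X_{2,3} X_{2,4} (X_{1,1} X_{1,2}) - X_{1,1} X_{1,2} (X_{2,3} X_{2,4}), \end{aligned}$$ where each element is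 included only if all its row and column indices are at most $n$. **Theorem.** The image of $d$ is $\operatorname{perm}_n^\perp$, and the module $\ker d$ of all relations of $\operatorname{perm}_n^\perp$ is generated as an $S$-module by the orbits of the linear relations $\rho_1',\dots,\rho_5',\rho_S'$ and of the quadratic relation $\rho_Q'$ under permuting rows and columns and transposing. If $\operatorname{char}\Bbbk=2$, the same holds for $\det_n^\perp$, where the last family of generators is written $X_{i,j}X_{m,l}+X_{i,l}X_{m,j}$ (and the signs in the relations are immaterial). -/

import Mathlib

namespace PermSyzygy

open MvPolynomial

noncomputable section

/-! ### Apolarity -/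

/-- The contraction `g ⋆ f`, as a `k`-linear map in `g`: the monomial `X ^ s` sends `x ^ (s + t)` to
`x ^ t`, and sends to `0` every monomial that `x ^ s` does not divide. -/
def contract {τ k : Type*} [Field k] (f : MvPolynomial τ k) :
    MvPolynomial τ k →ₗ[k] MvPolynomial τ k :=
  (basisMonomials τ k).constr k fun s => f.divMonomial s

theorem contract_monomial {τ k : Type*} [Field k] (f : MvPolynomial τ k) (s : τ →₀ ℕ) (a : k) :
    contract f (monomial s a) = a • f.divMonomial s := by
  have h : (monomial s a : MvPolynomial τ k) = a • basisMonomials τ k s := by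
    simp [coe_basisMonomials, smul_monomial]
  rw [h, map_smul, contract, Module.Basis.constr_basis]

theorem smul_divMonomial {τ k : Type*} [Field k] (a : k) (f : MvPolynomial τ k) (s : τ →₀ ℕ) :
    (a • f).divMonomial s = a • f.divMonomial s := by
  ext m
  simp [coeff_divMonomial]

theorem contract_mul {τ k : Type*} [Field k] (f h g : MvPolynomial τ k) :
    contract f (h * g) = contract (contract f g) h := by
  induction h using MvPolynomial.induction_on' with
  | add p q hp hq => rw [add_mul, map_add, map_add, hp, hq]
  | monomial s a =>
    induction g using MvPolynomial.induction_on' with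
    | add p q hp hq =>
      rw [mul_add, map_add, map_add, hp, hq]
      simp only [contract_monomial, add_divMonomial, smul_add]
    | monomial t b =>
      rw [monomial_mul, contract_monomial, contract_monomial, contract_monomial,
        smul_divMonomial, ← divMonomial_add, add_comm s t, mul_smul]

/-- The apolar ideal `f^⊥ = {g | g ⋆ f = 0}`. -/
def apolarIdeal {τ k : Type*} [Field k] (f : MvPolynomial τ k) : Ideal (MvPolynomial τ k) where
  carrier := {g | contract f g = 0}
  zero_mem' := map_zero _
  add_mem' := by
    intro a b ha hb
    simp only [Set.mem_ofPred_eq] at *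
    rw [map_add, ha, hb, add_zero]
  smul_mem' := by
    intro c g hg
    simp only [Set.mem_ofPred_eq] at *
    rw [smul_eq_mul, contract_mul, hg]
    induction c using MvPolynomial.induction_on' with
    | add p q hp hq => rw [map_add, hp, hq, add_zero]
    | monomial s a => rw [contract_monomial, zero_divMonomial, smul_zero]

/-- The polynomial ring in the entries of an `n × n` matrix. -/
abbrev S (k : Type*) [Field k] (n : ℕ) : Type _ := MvPolynomial (Fin n × Fin n) k

/-- The generic permanent. -/
def permPoly (k : Type*) [Field k] (n : ℕ) : S k n :=
  (Matrix.mvPolynomialX (Fin n) (Fin n) k).permanent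

/-- The generic determinant. -/
def detPoly (k : Type*) [Field k] (n : ℕ) : S k n :=
  (Matrix.mvPolynomialX (Fin n) (Fin n) k).det

/-! ### The quadratic generators and the free module on them -/

/-- Labels for the minimal generators: `sq i j` for `X_{ij}²`, `row i j l` for `X_{ij} X_{il}`,
`col i k j` for `X_{ij} X_{kj}`, and `rect i k j l` for `X_{ij} X_{kl} ∓ X_{il} X_{kj}`. The
inequalities list each generator (up to sign) exactly once. -/
inductive Gen (n : ℕ) : Type
  | sq (i j : Fin n) : Gen n
  | row (i j l : Fin n) (h : j < l) : Gen n
  | col (i k j : Fin n) (h : i < k) : Gen n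
  | rect (i k j l : Fin n) (hik : i < k) (hjl : j < l) : Gen n

/-- The generators of the apolar ideal of the permanent. -/
def permGen (k : Type*) [Field k] (n : ℕ) : Gen n → S k n
  | .sq i j => X (i, j) ^ 2
  | .row i j l _ => X (i, j) * X (i, l)
  | .col i m j _ => X (i, j) * X (m, j)
  | .rect i m j l _ _ => X (i, j) * X (m, l) - X (i, l) * X (m, j)

/-- The generators of the apolar ideal of the determinant. -/
def detGen (k : Type*) [Field k] (n : ℕ) : Gen n → S k n
  | .sq i j => X (i, j) ^ 2
  | .row i j l _ => X (i, j) * X (i, l)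
  | .col i m j _ => X (i, j) * X (m, j)
  | .rect i m j l _ _ => X (i, j) * X (m, l) + X (i, l) * X (m, j)

/-- The free `S`-module on the generators. -/
abbrev F (k : Type*) [Field k] (n : ℕ) : Type _ := Gen n →₀ S k n

/-- The presentation map: a formal combination of generators is sent to its value in `S`.
Relations are the elements of its kernel. -/
def d {k : Type*} [Field k] {n : ℕ} (q : Gen n → S k n) : F k n →ₗ[S k n] S k n :=
  Finsupp.linearCombination (S k n) q

section FormalGenerators

variable {k : Type*} [Field k] {n : ℕ}

/-- The basis element `(X_{ij}²)`. -/
def sq (i j : Fin n) : F k n := Finsupp.single (.sq i j) 1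

/-- The basis element `(X_{ij} X_{il})`, symmetric in `j, l`. -/
def row (i j l : Fin n) : F k n :=
  if h : j < l then Finsupp.single (.row i j l h) 1
  else if h : l < j then Finsupp.single (.row i l j h) 1
  else sq i j

/-- The basis element `(X_{ij} X_{mj})`, symmetric in `i, m`. -/
def col (i m j : Fin n) : F k n :=
  if h : i < m then Finsupp.single (.col i m j h) 1
  else if h : m < i then Finsupp.single (.col m i j h) 1
  else sq i j

/-- The element `(X_{ij} X_{ml} - X_{il} X_{mj})`: up to the sign coming from the order of `i, m`
and of `j, l`, it is a basis element (and it is zero if `i = m` or `j = l`). -/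
def rect (i m j l : Fin n) : F k n :=
  if him : i < m then
    if hjl : j < l then Finsupp.single (.rect i m j l him hjl) 1
    else if hlj : l < j then -Finsupp.single (.rect i m l j him hlj) 1
    else 0
  else if hmi : m < i then
    if hjl : j < l then -Finsupp.single (.rect m i j l hmi hjl) 1
    else if hlj : l < j then Finsupp.single (.rect m i l j hmi hlj) 1
    else 0
  else 0

/-! ### Symmetries of the free module -/

/-- The formal generator obtained by permuting rows by `σ` and columns by `π`. -/
def genPermute (σ π : Equiv.Perm (Fin n)) : Gen n → F k n
  | .sq i j => sq (σ i) (π j)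
  | .row i j l _ => row (σ i) (π j) (π l)
  | .col i m j _ => col (σ i) (σ m) (π j)
  | .rect i m j l _ _ => rect (σ i) (σ m) (π j) (π l)

/-- The formal generator obtained by transposing. -/
def genTranspose : Gen n → F k n
  | .sq i j => sq j i
  | .row i j l _ => col j l i
  | .col i m j _ => row j i m
  | .rect i m j l _ _ => rect j l i m

/-- Permuting rows by `σ` and columns by `π`, i.e. `X_{ij} ↦ X_{σ(i) π(j)}` in coefficients and
generators. -/
def permute (σ π : Equiv.Perm (Fin n)) (x : F k n) : F k n :=
  x.sum fun g s => rename (Prod.map σ π) s • genPermute σ π g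

/-- Transposing, i.e. `X_{ij} ↦ X_{ji}` in coefficients and generators. -/
def transpose (x : F k n) : F k n :=
  x.sum fun g s => rename Prod.swap s • genTranspose g

/-- The orbit under permuting rows and columns and transposing. -/
def orbit (x : F k n) : Set (F k n) :=
  {y | ∃ σ π : Equiv.Perm (Fin n), y = permute σ π x ∨ y = permute σ π (transpose x)}

/-! ### The explicit relations

The rows and columns with numbers `1, 2, 3, 4` are `ι 0, ι 1, ι 2, ι 3`. -/

/-- `X₁₂ (X₁₁²) - X₁₁ (X₁₁ X₁₂)` -/
def rho1 (ι : Fin 2 → Fin n) : F k n :=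
  (X (ι 0, ι 1) : S k n) • sq (ι 0) (ι 0)
    - (X (ι 0, ι 0) : S k n) • row (ι 0) (ι 0) (ι 1)

/-- `X₁₃ (X₁₁ X₁₂) - X₁₂ (X₁₁ X₁₃)` -/
def rho2 (ι : Fin 3 → Fin n) : F k n :=
  (X (ι 0, ι 2) : S k n) • row (ι 0) (ι 0) (ι 1)
    - (X (ι 0, ι 1) : S k n) • row (ι 0) (ι 0) (ι 2)

/-- `X₂₁ (X₁₁ X₁₂) - X₁₂ (X₁₁ X₂₁)` -/
def rho3 (ι : Fin 2 → Fin n) : F k n :=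
  (X (ι 1, ι 0) : S k n) • row (ι 0) (ι 0) (ι 1)
    - (X (ι 0, ι 1) : S k n) • col (ι 0) (ι 1) (ι 0)

/-- `X₁₁ (X₁₁ X₂₂ - X₁₂ X₂₁) + X₂₁ (X₁₁ X₁₂) - X₂₂ (X₁₁²)` -/
def rho4 (ι : Fin 2 → Fin n) : F k n :=
  (X (ι 0, ι 0) : S k n) • rect (ι 0) (ι 1) (ι 0) (ι 1)
    + (X (ι 1, ι 0) : S k n) • row (ι 0) (ι 0) (ι 1)
    - (X (ι 1, ι 1) : S k n) • sq (ι 0) (ι 0)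

/-- `X₁₃ (X₁₁ X₂₂ - X₁₂ X₂₁) - X₂₂ (X₁₁ X₁₃) + X₂₁ (X₁₂ X₁₃)` -/
def rho5 (ι : Fin 3 → Fin n) : F k n :=
  (X (ι 0, ι 2) : S k n) • rect (ι 0) (ι 1) (ι 0) (ι 1)
    - (X (ι 1, ι 1) : S k n) • row (ι 0) (ι 0) (ι 2)
    + (X (ι 1, ι 0) : S k n) • row (ι 0) (ι 1) (ι 2)

/-- `X₃₃ (X₁₁ X₂₂ - X₁₂ X₂₁) - X₁₂ (X₂₃ X₃₁ - X₂₁ X₃₃) + X₂₃ (X₁₂ X₃₁ - X₁₁ X₃₂)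
- X₁₁ (X₂₂ X₃₃ - X₂₃ X₃₂)` -/
def rhoS (ι : Fin 3 → Fin n) : F k n :=
  (X (ι 2, ι 2) : S k n) • rect (ι 0) (ι 1) (ι 0) (ι 1)
    - (X (ι 0, ι 1) : S k n) • rect (ι 1) (ι 2) (ι 2) (ι 0)
    + (X (ι 1, ι 2) : S k n) • rect (ι 0) (ι 2) (ι 1) (ι 0)
    - (X (ι 0, ι 0) : S k n) • rect (ι 1) (ι 2) (ι 1) (ι 2)

/-- `X₂₃ X₂₄ (X₁₁ X₁₂) - X₁₁ X₁₂ (X₂₃ X₂₄)` -/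
def rhoQ (ι : Fin 4 → Fin n) : F k n :=
  (X (ι 1, ι 2) * X (ι 1, ι 3) : S k n) • row (ι 0) (ι 0) (ι 1)
    - (X (ι 0, ι 0) * X (ι 0, ι 1) : S k n) • row (ι 1) (ι 2) (ι 3)

end FormalGenerators

/-- The linear relations `ρ'₁, …, ρ'₅, ρ'_S`, each one present as soon as `n` is large enough for
all its row and column numbers to be at most `n`. -/
def linearRelations (k : Type*) [Field k] (n : ℕ) : Set (F k n) :=
  {x | (∃ h : 2 ≤ n, x = rho1 (Fin.castLE h) ∨ x = rho3 (Fin.castLE h) ∨ x = rho4 (Fin.castLE h)) ∨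
    (∃ h : 3 ≤ n, x = rho2 (Fin.castLE h) ∨ x = rho5 (Fin.castLE h) ∨ x = rhoS (Fin.castLE h))}

/-- The quadratic relation `ρ'_Q`, present as soon as `4 ≤ n`. -/
def quadraticRelations (k : Type*) [Field k] (n : ℕ) : Set (F k n) :=
  {x | ∃ h : 4 ≤ n, x = rhoQ (Fin.castLE h)}

/-- The submodule generated by the orbits of all these relations. -/
def orbitSpan (k : Type*) [Field k] (n : ℕ) : Submodule (S k n) (F k n) :=
  Submodule.span (S k n) (⋃ x ∈ linearRelations k n ∪ quadraticRelations k n, orbit x)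

end

end PermSyzygy

namespace PermSyzygy

open MvPolynomial

noncomputable section

/-! ### Symmetries of the formal generators -/

section Symmetries

variable {k : Type*} [Field k] {n : ℕ}

/-! Relations. Let `Q` be the free module modulo `orbitSpan`. It suffices to build a `k`-linear map
`valueMap : S → Q` whose composite with `d` is the quotient map, since then anything killed by `d`
vanishes in `Q` (`valueMap_d`, `ker_d_permGen`). The map is prescribed on monomials, which are of
two kinds. If a monomial contains two cells (possibly equal) in a common row or column, it is sent
to its cofactor times the class of that monomial generator. The choice of pair is immaterial: pairs
sharing a cell are compared by linear relations, disjoint pairs by Koszul relations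
(`conf_smul_eq`). Only the Koszul relation of two products in different rows on four different
columns, and its transpose, must be imposed; the others needed follow from the linear ones by
passing through a 2 × 2 permanent.

The remaining monomials are placements of non-attacking rooks. The binomial generators prescribe the
difference of values when two rooks exchange columns. Such a prescription comes from a potential as
soon as it respects (a b) = (a c)(b c)(a c) (`exists_potential`), and this identity is exactly the
relation `rhoS` (`edge_tri`). It remains to see that binomial generators are also respected on
monomials with a conflict (`value_sub_value`).

Image. Modulo the generators, monomials with a conflict vanish and a placement depends only on its
sets of rows and columns. Contracting with the permanent recovers, for each such pair of sets, the
sum of the coefficients of the placements on it; if all these sums vanish, the polynomial lies in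
the image (`range_d_permGen`).

The calculus in `Q` is done in the abstract structure `RelSystem`, which is closed under
transposition, so that each column statement is a row statement of the transposed system. In
characteristic two, determinant and permanent coincide. -/

theorem row_comm (i j l : Fin n) : (row i j l : F k n) = row i l j := by
  unfold row
  split_ifs <;> first | rfl | omega | (have : j = l := by omega); subst this; rfl

theorem col_comm (i m j : Fin n) : (col i m j : F k n) = col m i j := by
  unfold col
  split_ifs <;> first | rfl | omega | (have : i = m := by omega); subst this; rfl

theorem row_self (i j : Fin n) : (row i j j : F k n) = sq i j := by simp [row]

theorem col_self (i j : Fin n) : (col i i j : F k n) = sq i j := by simp [col]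

theorem rect_self_row (i j l : Fin n) : (rect i i j l : F k n) = 0 := by simp [rect]

theorem rect_self_col (i m j : Fin n) : (rect i m j j : F k n) = 0 := by simp [rect]

theorem rect_swap_row (i m j l : Fin n) : (rect m i j l : F k n) = -rect i m j l := by
  unfold rect
  split_ifs <;> first | omega | simp

theorem rect_swap_col (i m j l : Fin n) : (rect i m l j : F k n) = -rect i m j l := by
  unfold rect
  split_ifs <;> first | omega | simp

theorem row_of_lt {i j l : Fin n} (h : j < l) :
    (row i j l : F k n) = Finsupp.single (.row i j l h) 1 := by simp [row, h]

theorem col_of_lt {i m j : Fin n} (h : i < m) :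
    (col i m j : F k n) = Finsupp.single (.col i m j h) 1 := by simp [col, h]

theorem rect_of_lt {i m j l : Fin n} (h : i < m) (h' : j < l) :
    (rect i m j l : F k n) = Finsupp.single (.rect i m j l h h') 1 := by simp [rect, h, h']

theorem permute_add (σ π : Equiv.Perm (Fin n)) (x y : F k n) :
    permute σ π (x + y) = permute σ π x + permute σ π y :=
  Finsupp.sum_add_index' (by simp) (by simp [add_smul])

theorem permute_zero (σ π : Equiv.Perm (Fin n)) : permute σ π (0 : F k n) = 0 :=
  Finsupp.sum_zero_index

theorem permute_single (σ π : Equiv.Perm (Fin n)) (g : Gen n) (s : S k n) :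
    permute σ π (Finsupp.single g s) = rename (Prod.map σ π) s • genPermute σ π g :=
  Finsupp.sum_single_index (by simp)

theorem permute_smul (σ π : Equiv.Perm (Fin n)) (s : S k n) (x : F k n) :
    permute σ π (s • x) = rename (Prod.map σ π) s • permute σ π x := by
  induction x using Finsupp.induction_linear with
  | zero => simp [permute_zero]
  | add x y hx hy => rw [smul_add, permute_add, permute_add, hx, hy, smul_add]
  | single g t =>
    rw [Finsupp.smul_single, permute_single, permute_single, smul_eq_mul, map_mul, mul_smul]

theorem permute_neg (σ π : Equiv.Perm (Fin n)) (x : F k n) :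
    permute σ π (-x) = -permute σ π x := by
  have := permute_smul σ π (-1 : S k n) x
  simpa using this

theorem permute_sub (σ π : Equiv.Perm (Fin n)) (x y : F k n) :
    permute σ π (x - y) = permute σ π x - permute σ π y := by
  rw [sub_eq_add_neg, permute_add, permute_neg, ← sub_eq_add_neg]

theorem permute_sq (σ π : Equiv.Perm (Fin n)) (i j : Fin n) :
    permute σ π (sq i j : F k n) = sq (σ i) (π j) := by
  rw [sq, permute_single]; simp [genPermute]

theorem permute_row (σ π : Equiv.Perm (Fin n)) (i j l : Fin n) :
    permute σ π (row i j l : F k n) = row (σ i) (π j) (π l) := by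
  rcases lt_trichotomy j l with h | rfl | h
  · rw [row_of_lt h, permute_single]; simp [genPermute]
  · rw [row_self, row_self, permute_sq]
  · rw [row_comm, row_of_lt h, permute_single, row_comm (σ i)]; simp [genPermute]

theorem permute_col (σ π : Equiv.Perm (Fin n)) (i m j : Fin n) :
    permute σ π (col i m j : F k n) = col (σ i) (σ m) (π j) := by
  rcases lt_trichotomy i m with h | rfl | h
  · rw [col_of_lt h, permute_single]; simp [genPermute]
  · rw [col_self, col_self, permute_sq]
  · rw [col_comm, col_of_lt h, permute_single, col_comm (σ i)]; simp [genPermute]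

theorem permute_rect (σ π : Equiv.Perm (Fin n)) (i m j l : Fin n) :
    permute σ π (rect i m j l : F k n) = rect (σ i) (σ m) (π j) (π l) := by
  have key : ∀ {i m j l : Fin n}, i < m → j < l →
      permute σ π (rect i m j l : F k n) = rect (σ i) (σ m) (π j) (π l) := by
    intro i m j l h h'
    rw [rect_of_lt h h', permute_single]; simp [genPermute]
  have key' : ∀ {i m : Fin n} (j l : Fin n), i < m →
      permute σ π (rect i m j l : F k n) = rect (σ i) (σ m) (π j) (π l) := by
    intro i m j l h
    rcases lt_trichotomy j l with h' | rfl | h'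
    · exact key h h'
    · rw [rect_self_col, rect_self_col, permute_zero]
    · rw [rect_swap_col, permute_neg, key h h', rect_swap_col (σ i), neg_neg]
  rcases lt_trichotomy i m with h | rfl | h
  · exact key' j l h
  · rw [rect_self_row, rect_self_row, permute_zero]
  · rw [rect_swap_row, permute_neg, key' j l h, rect_swap_row (σ m)]

theorem transpose_add (x y : F k n) : transpose (x + y) = transpose x + transpose y :=
  Finsupp.sum_add_index' (by simp) (by simp [add_smul])

theorem transpose_zero : transpose (0 : F k n) = 0 := Finsupp.sum_zero_index

theorem transpose_single (g : Gen n) (s : S k n) :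
    transpose (Finsupp.single g s) = rename Prod.swap s • genTranspose g :=
  Finsupp.sum_single_index (by simp)

theorem transpose_smul (s : S k n) (x : F k n) :
    transpose (s • x) = rename Prod.swap s • transpose x := by
  induction x using Finsupp.induction_linear with
  | zero => simp [transpose_zero]
  | add x y hx hy => rw [smul_add, transpose_add, transpose_add, hx, hy, smul_add]
  | single g t =>
    rw [Finsupp.smul_single, transpose_single, transpose_single, smul_eq_mul, map_mul, mul_smul]

theorem transpose_neg (x : F k n) : transpose (-x) = -transpose x := by
  have := transpose_smul (-1 : S k n) x
  simpa using this

theorem transpose_sub (x y : F k n) : transpose (x - y) = transpose x - transpose y := by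
  rw [sub_eq_add_neg, transpose_add, transpose_neg, ← sub_eq_add_neg]

theorem transpose_sq (i j : Fin n) : transpose (sq i j : F k n) = sq j i := by
  rw [sq, transpose_single]; simp [genTranspose]

theorem transpose_row (i j l : Fin n) : transpose (row i j l : F k n) = col j l i := by
  rcases lt_trichotomy j l with h | rfl | h
  · rw [row_of_lt h, transpose_single]; simp [genTranspose]
  · rw [row_self, col_self, transpose_sq]
  · rw [row_comm, row_of_lt h, transpose_single, col_comm]; simp [genTranspose]

theorem transpose_rect (i m j l : Fin n) :
    transpose (rect i m j l : F k n) = rect j l i m := by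
  have key : ∀ {i m j l : Fin n}, i < m → j < l →
      transpose (rect i m j l : F k n) = rect j l i m := by
    intro i m j l h h'
    rw [rect_of_lt h h', transpose_single]; simp [genTranspose]
  have key' : ∀ {i m : Fin n} (j l : Fin n), i < m →
      transpose (rect i m j l : F k n) = rect j l i m := by
    intro i m j l h
    rcases lt_trichotomy j l with h' | rfl | h'
    · exact key h h'
    · rw [rect_self_col, rect_self_row, transpose_zero]
    · rw [rect_swap_col, transpose_neg, key h h', rect_swap_row l j]
  rcases lt_trichotomy i m with h | rfl | h
  · exact key' j l h
  · rw [rect_self_row, rect_self_col, transpose_zero]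
  · rw [rect_swap_row, transpose_neg, key' j l h, rect_swap_col j l m i]

/-! ### The relations lie in the kernel -/

theorem d_sq (i j : Fin n) : d (permGen k n) (sq i j) = X (i, j) * X (i, j) := by
  simp [d, sq, permGen, pow_two]

theorem d_row (i j l : Fin n) : d (permGen k n) (row i j l) = X (i, j) * X (i, l) := by
  rcases lt_trichotomy j l with h | rfl | h
  · rw [row_of_lt h]; simp [d, permGen]
  · rw [row_self, d_sq]
  · rw [row_comm, row_of_lt h]; simp [d, permGen, mul_comm]

theorem d_col (i m j : Fin n) : d (permGen k n) (col i m j) = X (i, j) * X (m, j) := by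
  rcases lt_trichotomy i m with h | rfl | h
  · rw [col_of_lt h]; simp [d, permGen]
  · rw [col_self, d_sq]
  · rw [col_comm, col_of_lt h]; simp [d, permGen, mul_comm]

theorem d_rect (i m j l : Fin n) :
    d (permGen k n) (rect i m j l) = X (i, j) * X (m, l) - X (i, l) * X (m, j) := by
  unfold rect
  split_ifs with h h' h'' h h' h''
  · simp [d, permGen]
  · simp [d, permGen]
  · obtain rfl : j = l := by omega
    simp
  · simp [d, permGen]; ring
  · simp [d, permGen]; ring
  · obtain rfl : j = l := by omega
    simp
  · obtain rfl : i = m := by omega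
    simp [mul_comm]

/-- Equivariance of the presentation map reduces the check on whole orbits to the seven explicit
relations. -/
theorem d_permute (σ π : Equiv.Perm (Fin n)) (x : F k n) :
    d (permGen k n) (permute σ π x) = rename (Prod.map σ π) (d (permGen k n) x) := by
  induction x using Finsupp.induction_linear with
  | zero => simp [permute_zero]
  | add x y hx hy => rw [permute_add, map_add, map_add, map_add, hx, hy]
  | single g t =>
    rw [permute_single, map_smul]
    cases g <;> simp [genPermute, d_sq, d_row, d_col, d_rect] <;> simp [d, permGen, pow_two]

theorem d_transpose (x : F k n) :
    d (permGen k n) (transpose x) = rename Prod.swap (d (permGen k n) x) := by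
  induction x using Finsupp.induction_linear with
  | zero => simp [transpose_zero]
  | add x y hx hy => rw [transpose_add, map_add, map_add, map_add, hx, hy]
  | single g t =>
    rw [transpose_single, map_smul]
    cases g <;> simp [genTranspose, d_sq, d_row, d_col, d_rect] <;>
      simp [d, permGen, pow_two, mul_comm]

theorem orbitSpan_le_ker : orbitSpan k n ≤ LinearMap.ker (d (permGen k n)) := by
  rw [orbitSpan, Submodule.span_le]
  intro y hy
  simp only [Set.mem_iUnion] at hy
  obtain ⟨x, hx, σ, π, hy⟩ := hy
  have hdx : d (permGen k n) x = 0 := by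
    rcases hx with (⟨h, rfl | rfl | rfl⟩ | ⟨h, rfl | rfl | rfl⟩) | ⟨h, rfl⟩ <;>
      simp only [rho1, rho2, rho3, rho4, rho5, rhoS, rhoQ, map_add, map_sub, map_smul,
        smul_eq_mul, d_sq, d_row, d_col, d_rect] <;> ring
  rcases hy with rfl | rfl <;> simp [d_permute, d_transpose, hdx]

end Symmetries

/-! ### Abstract systems of relations -/

/-- Elements `row`, `col`, `rect` of a module satisfying the listed relations together with their
transposes. -/
structure RelSystem (ι A M : Type*) [CommRing A] [AddCommGroup M] [Module A M] where
  x : ι → ι → A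
  row : ι → ι → ι → M
  col : ι → ι → ι → M
  rect : ι → ι → ι → ι → M
  row_comm : ∀ i j l, row i j l = row i l j
  col_comm : ∀ i m j, col i m j = col m i j
  row_self : ∀ i j, row i j j = col i i j
  rect_swap_row : ∀ i m j l, rect m i j l = -rect i m j l
  rect_swap_col : ∀ i m j l, rect i m l j = -rect i m j l
  rect_self_row : ∀ i j l, rect i i j l = 0
  rect_self_col : ∀ i m j, rect i m j j = 0
  sq_row : ∀ {i j l}, j ≠ l → x i l • row i j j = x i j • row i j l
  sq_col : ∀ {i m j}, i ≠ m → x m j • col i i j = x i j • col i m j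
  row_row : ∀ {i j l t}, j ≠ l → j ≠ t → l ≠ t → x i t • row i j l = x i l • row i j t
  col_col : ∀ {i m t j}, i ≠ m → i ≠ t → m ≠ t → x t j • col i m j = x m j • col i t j
  row_col : ∀ {i m j l}, i ≠ m → j ≠ l → x m j • row i j l = x i l • col i m j
  sq_rect_row : ∀ {i m j l}, i ≠ m → j ≠ l →
    x i j • rect i m j l = x m l • row i j j - x m j • row i j l
  sq_rect_col : ∀ {i m j l}, i ≠ m → j ≠ l →
    x i j • rect i m j l = x m l • col i i j - x i l • col i m j
  row_rect : ∀ {i m j l t}, i ≠ m → j ≠ l → j ≠ t → l ≠ t →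
    x i t • rect i m j l = x m l • row i j t - x m j • row i l t
  col_rect : ∀ {i m j l t}, i ≠ m → j ≠ l → i ≠ t → m ≠ t →
    x t j • rect i m j l = x m l • col i t j - x i l • col m t j
  rect_rect_row : ∀ {i m p j l q}, i ≠ m → i ≠ p → m ≠ p → j ≠ l → j ≠ q → l ≠ q →
    x p q • rect i m j l = x m l • rect i p j q + x i q • rect m p l j + x m j • rect i p q l
  rect_rect_col : ∀ {i m p j l q}, i ≠ m → i ≠ p → m ≠ p → j ≠ l → j ≠ q → l ≠ q →
    x p q • rect i m j l = x m l • rect i p j q + x p j • rect m i l q + x i l • rect p m j q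
  koszul_row : ∀ {i p j l q s}, i ≠ p → j ≠ l → j ≠ q → j ≠ s → l ≠ q → l ≠ s → q ≠ s →
    (x p q * x p s) • row i j l = (x i j * x i l) • row p q s
  koszul_col : ∀ {j q i m p r}, j ≠ q → i ≠ m → i ≠ p → i ≠ r → m ≠ p → m ≠ r → p ≠ r →
    (x p q * x r q) • col i m j = (x i j * x m j) • col p r q

namespace RelSystem

variable {ι A M : Type*} [CommRing A] [AddCommGroup M] [Module A M]

/-- The transposed system. -/
def transpose (R : RelSystem ι A M) : RelSystem ι A M where
  x i j := R.x j i
  row i j l := R.col j l i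
  col i m j := R.row j i m
  rect i m j l := R.rect j l i m
  row_comm i j l := R.col_comm j l i
  col_comm i m j := R.row_comm j i m
  row_self i j := (R.row_self j i).symm
  rect_swap_row i m j l := R.rect_swap_col j l i m
  rect_swap_col i m j l := R.rect_swap_row j l i m
  rect_self_row i j l := R.rect_self_col j l i
  rect_self_col i m j := R.rect_self_row j i m
  sq_row h := R.sq_col h
  sq_col h := R.sq_row h
  row_row h₁ h₂ h₃ := R.col_col h₁ h₂ h₃
  col_col h₁ h₂ h₃ := R.row_row h₁ h₂ h₃
  row_col h₁ h₂ := (R.row_col h₂ h₁).symm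
  sq_rect_row h₁ h₂ := R.sq_rect_col h₂ h₁
  sq_rect_col h₁ h₂ := R.sq_rect_row h₂ h₁
  row_rect h₁ h₂ h₃ h₄ := R.col_rect h₂ h₁ h₃ h₄
  col_rect h₁ h₂ h₃ h₄ := R.row_rect h₂ h₁ h₃ h₄
  rect_rect_row h₁ h₂ h₃ h₄ h₅ h₆ := R.rect_rect_col h₄ h₅ h₆ h₁ h₂ h₃
  rect_rect_col h₁ h₂ h₃ h₄ h₅ h₆ := R.rect_rect_row h₄ h₅ h₆ h₁ h₂ h₃
  koszul_row h₁ h₂ h₃ h₄ h₅ h₆ h₇ := R.koszul_col h₁ h₂ h₃ h₄ h₅ h₆ h₇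
  koszul_col h₁ h₂ h₃ h₄ h₅ h₆ h₇ := R.koszul_row h₁ h₂ h₃ h₄ h₅ h₆ h₇

variable (R : RelSystem ι A M)

/-! The relations for arbitrary, possibly coinciding, indices. -/

/-- With squares counted as `row i j j`, the relations `rho1` and `rho2` become one uniform exchange
rule, so later arguments need not ask which cells coincide. -/
theorem smul_row_row (i j l t : ι) : R.x i t • R.row i j l = R.x i l • R.row i j t := by
  by_cases h₁ : l = t
  · rw [h₁]
  by_cases h₂ : j = l
  · subst h₂; exact R.sq_row h₁
  by_cases h₃ : j = t
  · subst h₃; exact (R.sq_row h₂).symm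
  exact R.row_row h₂ h₃ h₁

theorem smul_col_col (i m t j : ι) : R.x t j • R.col i m j = R.x m j • R.col i t j :=
  R.transpose.smul_row_row j i m t

theorem smul_row_col (i m j l : ι) : R.x m j • R.row i j l = R.x i l • R.col i m j := by
  by_cases h₁ : i = m
  · subst h₁
    rw [R.smul_row_row i j l j, R.row_self]
  by_cases h₂ : j = l
  · subst h₂; rw [R.row_self, R.smul_col_col]
  exact R.row_col h₁ h₂

theorem smul_row_rect (i m j l t : ι) :
    R.x i t • R.rect i m j l = R.x m l • R.row i j t - R.x m j • R.row i l t := by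
  by_cases h₁ : i = m
  · subst h₁
    rw [R.rect_self_row, smul_zero, R.row_comm i j t, R.row_comm i l t, R.smul_row_row, sub_self]
  by_cases h₂ : j = l
  · subst h₂; rw [R.rect_self_col, smul_zero, sub_self]
  by_cases h₃ : j = t
  · subst h₃; rw [R.sq_rect_row h₁ h₂, R.row_comm i l j]
  by_cases h₄ : l = t
  · subst h₄
    have h := R.sq_rect_row h₁ (Ne.symm h₂)
    rw [R.rect_swap_col] at h
    rw [R.row_comm i j l]
    linear_combination (norm := module) (-1 : A) • h
  exact R.row_rect h₁ h₂ h₃ h₄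

theorem smul_col_rect (i m j l t : ι) :
    R.x t j • R.rect i m j l = R.x m l • R.col i t j - R.x i l • R.col m t j :=
  R.transpose.smul_row_rect j l i m t

/-- The three-term relation between the `2 × 2` permanents of a `2 × 3` matrix. -/
theorem smul_rect_two_rows (i p j l q : ι) :
    R.x i l • R.rect i p j q + R.x i q • R.rect i p l j + R.x i j • R.rect i p q l = 0 := by
  rw [R.smul_row_rect, R.smul_row_rect, R.smul_row_rect, R.row_comm i q l, R.row_comm i l j,
    R.row_comm i q j]
  abel

theorem smul_rect_two_cols (j q i m p : ι) :
    R.x m j • R.rect i p j q + R.x p j • R.rect m i j q + R.x i j • R.rect p m j q = 0 :=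
  R.transpose.smul_rect_two_rows j q i m p

/-- When rows or columns coincide, this degenerates to the three-term relation of a 2 × 3 or 3 × 2
matrix or to a trivial identity; only three distinct rows and columns need `rhoS`. -/
theorem smul_rect_rect (i m p j l q : ι) :
    R.x p q • R.rect i m j l =
      R.x m l • R.rect i p j q + R.x i q • R.rect m p l j + R.x m j • R.rect i p q l := by
  by_cases h₁ : i = m
  · subst h₁
    rw [R.rect_self_row, smul_zero, R.smul_rect_two_rows]
  by_cases h₂ : i = p
  · subst h₂
    rw [R.rect_self_row, R.rect_self_row, R.rect_swap_row i m l j, R.rect_swap_col i m j l]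
    simp
  by_cases h₃ : m = p
  · subst h₃
    have h := R.smul_rect_two_rows m i j l q
    rw [R.rect_swap_row i m, R.rect_swap_row i m, R.rect_swap_row i m] at h
    rw [R.rect_self_row]
    rw [R.rect_swap_col i m j l] at h
    linear_combination (norm := module) h
  by_cases h₄ : j = l
  · subst h₄
    rw [R.rect_self_col, R.rect_self_col, R.rect_swap_col i p j q]
    simp
  by_cases h₅ : j = q
  · subst h₅
    have h := R.smul_rect_two_cols j l i m p
    rw [R.rect_swap_row i m, R.rect_swap_row m p] at h
    rw [R.rect_self_col, R.rect_swap_col m p j l]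
    linear_combination (norm := module) (-1 : A) • h
  by_cases h₆ : l = q
  · subst h₆
    have h := R.smul_rect_two_cols l j i m p
    rw [R.rect_swap_row i m, R.rect_swap_row m p, R.rect_swap_col i p j l,
      R.rect_swap_col i m j l] at h
    rw [R.rect_self_col]
    linear_combination (norm := module) h
  exact R.rect_rect_row h₁ h₂ h₃ h₄ h₅ h₆

/-! ### Koszul relations involving a product of two cells in conflict -/

theorem koszul_row_col (i p r q j l : ι) :
    (R.x p q * R.x r q) • R.row i j l = (R.x i j * R.x i l) • R.col p r q := by
  -- Both sides arise by expanding `x i l * x r q` times `rect i p j q`, once through row `i` and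
  -- once through column `q`; the leftover terms agree by `h₂`.
  have h₁ := R.smul_row_rect i p j q l
  have h₂ := R.smul_row_col i r q l
  have h₃ := R.smul_col_rect p i q j r
  rw [R.rect_swap_row i p, R.rect_swap_col i p j q, neg_neg] at h₃
  linear_combination (norm := module) -(R.x r q) • h₁ + R.x p j • h₂ + R.x i l • h₃

/-- Expand `x i j * x p s` times `rect i p j q` through row `i` and through row `p`. The leftover
terms are multiples of `row i j q` and `row p j s`; they share column `j` and so both reduce to `col
i p j`. For four distinct columns the leftovers would share no column, and this argument stops. -/
theorem koszul_row_row_sq (i p j q s : ι) :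
    (R.x p q * R.x p s) • R.row i j j = (R.x i j * R.x i j) • R.row p q s := by
  have h₁ := R.smul_row_rect i p j q j
  have h₂ := R.smul_row_col i p q j
  have h₃ := R.smul_row_col p i j s
  have h₄ := R.smul_row_rect p i q j s
  rw [R.rect_swap_row i p, R.rect_swap_col i p j q, neg_neg] at h₄
  rw [R.col_comm p i j] at h₃
  have h₅ := R.smul_row_col i p j q
  rw [R.row_comm i q j] at h₁
  linear_combination (norm := module) -(R.x p s) • h₁ + R.x i j • h₄ + R.x p s • h₅ - R.x i q • h₃

theorem koszul_row_row (i p j l q s : ι) :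
    (R.x p q * R.x p s) • R.row i j l = (R.x i j * R.x i l) • R.row p q s := by
  by_cases h₀ : i = p
  · subst h₀
    have h₁ := R.smul_row_row i j l q
    have h₂ := R.smul_row_row i q j s
    rw [R.row_comm i q j] at h₂
    linear_combination (norm := module) R.x i s • h₁ + R.x i l • h₂
  -- If the two products share a column `j`, both are comparable with `col i p j`, so linear
  -- relations suffice.
  have share : ∀ j l s : ι,
      (R.x p j * R.x p s) • R.row i j l = (R.x i j * R.x i l) • R.row p j s := by
    intro j l s
    have h₁ := R.smul_row_col i p j l
    have h₂ := R.smul_row_col p i j s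
    rw [R.col_comm p i j] at h₂
    linear_combination (norm := module) R.x p s • h₁ - R.x i l • h₂
  by_cases h₁ : j = l
  · subst h₁; exact R.koszul_row_row_sq i p j q s
  by_cases h₂ : q = s
  · subst h₂; exact (R.koszul_row_row_sq p i q j l).symm
  by_cases h₃ : j = q
  · subst h₃; exact share j l s
  by_cases h₄ : j = s
  · subst h₄; rw [R.row_comm p q j, mul_comm (R.x p q)]; exact share j l q
  by_cases h₅ : l = q
  · subst h₅; rw [R.row_comm i j l, mul_comm (R.x i j)]; exact share l j s
  by_cases h₆ : l = s
  · subst h₆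
    rw [R.row_comm i j l, mul_comm (R.x i j), R.row_comm p q l, mul_comm (R.x p q)]
    exact share l j q
  exact R.koszul_row h₀ h₁ h₃ h₄ h₅ h₆ h₂

/-- `smul_rect_rect` with the cell `(p, q)` replaces the permanent by three permanents meeting row
`p`; multiplied by `x p s`, each of them becomes a combination of products in row `p`. -/
theorem koszul_row_rect (i m j l p q s : ι) :
    (R.x p q * R.x p s) • R.rect i m j l =
      (R.x i j * R.x m l - R.x i l * R.x m j) • R.row p q s := by
  have h := R.smul_rect_rect i m p j l q
  have h₁ := R.smul_row_rect p i q j s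
  rw [R.rect_swap_row i p, R.rect_swap_col i p j q, neg_neg] at h₁
  have h₂ := R.smul_row_rect p m j l s
  rw [R.rect_swap_row m p, R.rect_swap_col m p l j, neg_neg] at h₂
  have h₃ := R.smul_row_rect p i l q s
  rw [R.rect_swap_row i p, R.rect_swap_col i p q l, neg_neg] at h₃
  linear_combination (norm := module) R.x p s • h + R.x m l • h₁ + R.x i q • h₂ + R.x m j • h₃

/-! Two cells in a common row or column. -/

/-- Two cells (possibly equal) lie in a common row or column. -/
def Conflict (a b : ι × ι) : Prop := a.1 = b.1 ∨ a.2 = b.2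

theorem Conflict.symm {a b : ι × ι} (h : Conflict a b) : Conflict b a :=
  h.imp Eq.symm Eq.symm

open Classical in
/-- The generator attached to two cells in a common row or column. -/
def conf (a b : ι × ι) : M := if a.1 = b.1 then R.row a.1 a.2 b.2 else R.col a.1 b.1 a.2

/-- The variable of a cell. -/
def y (a : ι × ι) : A := R.x a.1 a.2

theorem conf_row (i j l : ι) : R.conf (i, j) (i, l) = R.row i j l := by simp [conf]

theorem conf_col (i m j : ι) : R.conf (i, j) (m, j) = R.col i m j := by
  unfold conf
  split_ifs with h
  · dsimp only at h ⊢; subst h; exact R.row_self i j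
  · rfl

theorem conflict_cases {P : ι × ι → ι × ι → Prop} (hrow : ∀ i j l, P (i, j) (i, l))
    (hcol : ∀ i m j, P (i, j) (m, j)) {a b : ι × ι} (h : Conflict a b) : P a b := by
  obtain ⟨i, j⟩ := a
  obtain ⟨m, l⟩ := b
  rcases h with h | h <;> dsimp only at h <;> subst h
  · exact hrow _ _ _
  · exact hcol _ _ _

theorem conf_comm {a b : ι × ι} (h : Conflict a b) : R.conf a b = R.conf b a := by
  refine conflict_cases (P := fun a b => R.conf a b = R.conf b a) ?_ ?_ h
  · intro i j l; rw [conf_row, conf_row, R.row_comm]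
  · intro i m j; rw [conf_col, conf_col, R.col_comm]

theorem smul_conf_conf {a b c : ι × ι} (h : Conflict a b) (h' : Conflict a c) :
    R.y c • R.conf a b = R.y b • R.conf a c := by
  obtain ⟨i, j⟩ := a
  obtain ⟨m, l⟩ := b
  obtain ⟨p, q⟩ := c
  rcases h with h | h <;> rcases h' with h' | h' <;> dsimp only at h h' <;> subst h <;>
    subst h' <;> simp only [conf_row, conf_col, y]
  · exact R.smul_row_row _ _ _ _
  · exact R.smul_row_col _ _ _ _
  · exact (R.smul_row_col _ _ _ _).symm
  · exact R.smul_col_col _ _ _ _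

theorem koszul_conf_conf {a b c e : ι × ι} (h : Conflict a b) (h' : Conflict c e) :
    (R.y c * R.y e) • R.conf a b = (R.y a * R.y b) • R.conf c e := by
  obtain ⟨i, j⟩ := a
  obtain ⟨m, l⟩ := b
  obtain ⟨p, q⟩ := c
  obtain ⟨r, s⟩ := e
  rcases h with h | h <;> rcases h' with h' | h' <;> dsimp only at h h' <;> subst h <;>
    subst h' <;> simp only [conf_row, conf_col, y]
  · exact R.koszul_row_row _ _ _ _ _ _
  · exact R.koszul_row_col _ _ _ _ _ _
  · exact (R.koszul_row_col _ _ _ _ _ _).symm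
  · exact R.transpose.koszul_row_row _ _ _ _ _ _

theorem koszul_conf_rect {a b : ι × ι} (h : Conflict a b) (i m j l : ι) :
    (R.y a * R.y b) • R.rect i m j l =
      (R.y (i, j) * R.y (m, l) - R.y (i, l) * R.y (m, j)) • R.conf a b := by
  refine conflict_cases (P := fun a b => (R.y a * R.y b) • R.rect i m j l =
      (R.y (i, j) * R.y (m, l) - R.y (i, l) * R.y (m, j)) • R.conf a b) ?_ ?_ h
  · intro p q s; rw [conf_row]; exact R.koszul_row_rect _ _ _ _ _ _ _
  · intro p r q
    rw [conf_col]
    have := R.transpose.koszul_row_rect j l i m q p r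
    simp only [transpose] at this
    rw [mul_comm (R.x m j)] at this
    exact this

end RelSystem

/-! ### The system of relations in the quotient by the orbit span -/

section Quotient

variable {k : Type*} [Field k] {n : ℕ}

theorem exists_perm_extending {m : ℕ} {u v : Fin m → Fin n} (hu : Function.Injective u)
    (hv : Function.Injective v) : ∃ σ : Equiv.Perm (Fin n), ∀ i, σ (u i) = v i := by
  obtain ⟨σ, hσ⟩ := (Equiv.Perm.isMultiplyPretransitive (Fin n) m).exists_smul_eq ⟨u, hu⟩ ⟨v, hv⟩
  exact ⟨σ, fun i => congrArg (fun e : Fin m ↪ Fin n => e i) hσ⟩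

/-- The quotient map by the span of the orbits. -/
def toQuot (k : Type*) [Field k] (n : ℕ) : F k n →ₗ[S k n] F k n ⧸ orbitSpan k n :=
  (orbitSpan k n).mkQ

theorem toQuot_eq_zero_iff {x : F k n} : toQuot k n x = 0 ↔ x ∈ orbitSpan k n :=
  Submodule.Quotient.mk_eq_zero _

theorem toQuot_permute {x : F k n} (hx : x ∈ linearRelations k n ∪ quadraticRelations k n)
    (σ π : Equiv.Perm (Fin n)) : toQuot k n (permute σ π x) = 0 :=
  toQuot_eq_zero_iff.2 <| Submodule.subset_span <|
    Set.mem_iUnion₂.2 ⟨x, hx, σ, π, Or.inl rfl⟩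

theorem toQuot_permute_transpose {x : F k n}
    (hx : x ∈ linearRelations k n ∪ quadraticRelations k n) (σ π : Equiv.Perm (Fin n)) :
    toQuot k n (permute σ π (transpose x)) = 0 :=
  toQuot_eq_zero_iff.2 <| Submodule.subset_span <|
    Set.mem_iUnion₂.2 ⟨x, hx, σ, π, Or.inr rfl⟩

theorem injective_pair {α : Type*} {a b : α} (h : a ≠ b) : Function.Injective ![a, b] := by
  intro i j hij
  fin_cases i <;> fin_cases j <;> simp_all

theorem injective_triple {α : Type*} {a b c : α} (h₁ : a ≠ b) (h₂ : a ≠ c) (h₃ : b ≠ c) :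
    Function.Injective ![a, b, c] := by
  intro i j hij
  fin_cases i <;> fin_cases j <;> simp_all

theorem injective_quadruple {α : Type*} {a b c e : α} (h₁ : a ≠ b) (h₂ : a ≠ c) (h₃ : a ≠ e)
    (h₄ : b ≠ c) (h₅ : b ≠ e) (h₆ : c ≠ e) : Function.Injective ![a, b, c, e] := by
  intro i j hij
  fin_cases i <;> fin_cases j <;> simp_all

theorem exists_perm_castLE {m : ℕ} {v : Fin m → Fin n} (hv : Function.Injective v) :
    ∃ h : m ≤ n, ∃ σ : Equiv.Perm (Fin n), ∀ i, σ (Fin.castLE h i) = v i := by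
  have h : m ≤ n := by simpa using Fintype.card_le_of_injective v hv
  exact ⟨h, exists_perm_extending (Fin.castLE_injective h) hv⟩

theorem exists_perm_single (a b : Fin n) : ∃ σ : Equiv.Perm (Fin n), σ a = b :=
  ⟨Equiv.swap a b, Equiv.swap_apply_left a b⟩

theorem exists_perm_pair {a b c e : Fin n} (h : a ≠ b) (h' : c ≠ e) :
    ∃ σ : Equiv.Perm (Fin n), σ a = c ∧ σ b = e := by
  obtain ⟨σ, hσ⟩ := exists_perm_extending (injective_pair h) (injective_pair h')
  exact ⟨σ, hσ 0, hσ 1⟩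

theorem quot_sq_row {i j l : Fin n} (h : j ≠ l) :
    (X (i, l) : S k n) • toQuot k n (row i j j) = (X (i, j) : S k n) • toQuot k n (row i j l) ∧
    (X (l, i) : S k n) • toQuot k n (col j j i) = (X (j, i) : S k n) • toQuot k n (col j l i) := by
  obtain ⟨hn, π, hπ⟩ := exists_perm_castLE (injective_pair h)
  obtain ⟨σ, hσ⟩ := exists_perm_single (Fin.castLE hn 0) i
  have hπ0 := hπ 0
  have hπ1 := hπ 1
  have hx : rho1 (Fin.castLE hn) ∈ linearRelations k n ∪ quadraticRelations k n :=
    Or.inl (Or.inl ⟨hn, Or.inl rfl⟩)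
  have h₁ := toQuot_permute hx σ π
  have h₂ := toQuot_permute_transpose hx π σ
  simp only [rho1, permute_sub, permute_smul, transpose_sub, transpose_smul, permute_sq,
    permute_row, permute_col, transpose_sq, transpose_row, rename_X, Prod.map_apply,
    Prod.swap_prod_mk, hσ, hπ0, hπ1, map_sub, map_smul, Matrix.cons_val_zero,
    Matrix.cons_val_one] at h₁ h₂
  rw [row_self, col_self]
  exact ⟨sub_eq_zero.1 h₁, sub_eq_zero.1 h₂⟩

theorem quot_row_row {i j l t : Fin n} (h₁ : j ≠ l) (h₂ : j ≠ t) (h₃ : l ≠ t) :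
    (X (i, t) : S k n) • toQuot k n (row i j l) = (X (i, l) : S k n) • toQuot k n (row i j t) ∧
    (X (t, i) : S k n) • toQuot k n (col j l i) = (X (l, i) : S k n) • toQuot k n (col j t i) := by
  obtain ⟨hn, π, hπ⟩ := exists_perm_castLE (injective_triple h₁ h₂ h₃)
  obtain ⟨σ, hσ⟩ := exists_perm_single (Fin.castLE hn 0) i
  have hπ0 := hπ 0
  have hπ1 := hπ 1
  have hπ2 := hπ 2
  have hx : rho2 (Fin.castLE hn) ∈ linearRelations k n ∪ quadraticRelations k n :=
    Or.inl (Or.inr ⟨hn, Or.inl rfl⟩)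
  have h₁ := toQuot_permute hx σ π
  have h₂ := toQuot_permute_transpose hx π σ
  simp only [rho2, permute_sub, permute_smul, transpose_sub, transpose_smul,
    permute_row, permute_col, transpose_row, rename_X, Prod.map_apply,
    Prod.swap_prod_mk, hσ, hπ0, hπ1, hπ2, map_sub, map_smul, Matrix.cons_val] at h₁ h₂
  exact ⟨sub_eq_zero.1 h₁, sub_eq_zero.1 h₂⟩

theorem quot_row_col {i m j l : Fin n} (h₁ : i ≠ m) (h₂ : j ≠ l) :
    (X (m, j) : S k n) • toQuot k n (row i j l) = (X (i, l) : S k n) • toQuot k n (col i m j) := by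
  obtain ⟨hn, σ, hσ⟩ := exists_perm_castLE (injective_pair h₁)
  obtain ⟨_, π, hπ⟩ := exists_perm_castLE (injective_pair h₂)
  have hσ0 := hσ 0
  have hσ1 := hσ 1
  have hπ0 := hπ 0
  have hπ1 := hπ 1
  have hx : rho3 (Fin.castLE hn) ∈ linearRelations k n ∪ quadraticRelations k n :=
    Or.inl (Or.inl ⟨hn, Or.inr (Or.inl rfl)⟩)
  have h₁ := toQuot_permute hx σ π
  simp only [rho3, permute_sub, permute_smul,
    permute_row, permute_col, rename_X, Prod.map_apply,
    hσ0, hσ1, hπ0, hπ1, map_sub, map_smul, Matrix.cons_val] at h₁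
  exact sub_eq_zero.1 h₁

theorem quot_sq_rect {i m j l : Fin n} (h₁ : i ≠ m) (h₂ : j ≠ l) :
    (X (i, j) : S k n) • toQuot k n (rect i m j l) =
      (X (m, l) : S k n) • toQuot k n (row i j j) - (X (m, j) : S k n) • toQuot k n (row i j l) ∧
    (X (j, i) : S k n) • toQuot k n (rect j l i m) =
      (X (l, m) : S k n) • toQuot k n (col j j i) -
        (X (j, m) : S k n) • toQuot k n (col j l i) := by
  obtain ⟨hn, σ, hσ⟩ := exists_perm_castLE (injective_pair h₁)
  obtain ⟨_, π, hπ⟩ := exists_perm_castLE (injective_pair h₂)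
  have hσ0 := hσ 0
  have hσ1 := hσ 1
  have hπ0 := hπ 0
  have hπ1 := hπ 1
  have hx : rho4 (Fin.castLE hn) ∈ linearRelations k n ∪ quadraticRelations k n :=
    Or.inl (Or.inl ⟨hn, Or.inr (Or.inr rfl)⟩)
  have h₁ := toQuot_permute hx σ π
  have h₂ := toQuot_permute_transpose hx π σ
  simp only [rho4, permute_sub, permute_add, permute_smul, transpose_sub, transpose_add,
    transpose_smul, permute_sq, permute_row, permute_col, permute_rect, transpose_sq,
    transpose_row, transpose_rect, rename_X, Prod.map_apply, map_add,
    Prod.swap_prod_mk, hσ0, hσ1, hπ0, hπ1, map_sub, map_smul, Matrix.cons_val] at h₁ h₂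
  rw [row_self, col_self]
  constructor
  · linear_combination (norm := module) h₁
  · linear_combination (norm := module) h₂

theorem quot_row_rect {i m j l t : Fin n} (h₁ : i ≠ m) (h₂ : j ≠ l) (h₃ : j ≠ t) (h₄ : l ≠ t) :
    (X (i, t) : S k n) • toQuot k n (rect i m j l) =
      (X (m, l) : S k n) • toQuot k n (row i j t) - (X (m, j) : S k n) • toQuot k n (row i l t) ∧
    (X (t, i) : S k n) • toQuot k n (rect j l i m) =
      (X (l, m) : S k n) • toQuot k n (col j t i) -
        (X (j, m) : S k n) • toQuot k n (col l t i) := by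
  obtain ⟨hn, π, hπ⟩ := exists_perm_castLE (injective_triple h₂ h₃ h₄)
  obtain ⟨σ, hσ0, hσ1⟩ := exists_perm_pair
    ((Fin.castLE_injective hn).ne (show (0 : Fin 3) ≠ 1 by decide)) h₁
  have hπ0 := hπ 0
  have hπ1 := hπ 1
  have hπ2 := hπ 2
  have hx : rho5 (Fin.castLE hn) ∈ linearRelations k n ∪ quadraticRelations k n :=
    Or.inl (Or.inr ⟨hn, Or.inr (Or.inl rfl)⟩)
  have h₁ := toQuot_permute hx σ π
  have h₂ := toQuot_permute_transpose hx π σ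
  simp only [rho5, permute_sub, permute_add, permute_smul, transpose_sub, transpose_add,
    transpose_smul, permute_row, permute_col, permute_rect,
    transpose_row, transpose_rect, rename_X, Prod.map_apply, map_add,
    Prod.swap_prod_mk, hσ0, hσ1, hπ0, hπ1, hπ2, map_sub, map_smul, Matrix.cons_val] at h₁ h₂
  constructor
  · linear_combination (norm := module) h₁
  · linear_combination (norm := module) h₂

theorem quot_rect_rect {i m p j l q : Fin n} (h₁ : i ≠ m) (h₂ : i ≠ p) (h₃ : m ≠ p) (h₄ : j ≠ l)
    (h₅ : j ≠ q) (h₆ : l ≠ q) :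
    (X (p, q) : S k n) • toQuot k n (rect i m j l) =
      (X (m, l) : S k n) • toQuot k n (rect i p j q) +
      (X (i, q) : S k n) • toQuot k n (rect m p l j) +
      (X (m, j) : S k n) • toQuot k n (rect i p q l) := by
  obtain ⟨hn, σ, hσ⟩ := exists_perm_castLE (injective_triple h₁.symm h₃ h₂)
  obtain ⟨_, π, hπ⟩ := exists_perm_castLE (injective_triple h₄.symm h₆ h₅)
  have hσ0 := hσ 0
  have hσ1 := hσ 1
  have hσ2 := hσ 2
  have hπ0 := hπ 0
  have hπ1 := hπ 1
  have hπ2 := hπ 2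
  have hx : rhoS (Fin.castLE hn) ∈ linearRelations k n ∪ quadraticRelations k n :=
    Or.inl (Or.inr ⟨hn, Or.inr (Or.inr rfl)⟩)
  have h₁ := toQuot_permute hx σ π
  simp only [rhoS, permute_sub, permute_add, permute_smul, permute_rect,
    rename_X, Prod.map_apply, map_add,
    hσ0, hσ1, hσ2, hπ0, hπ1, hπ2, map_sub, map_smul, Matrix.cons_val] at h₁
  rw [rect_swap_row i m l j, rect_swap_col i m j l, rect_swap_col m p l j, neg_neg, map_neg] at h₁
  linear_combination (norm := module) h₁

theorem quot_koszul {i p j l q s : Fin n} (h₀ : i ≠ p) (h₁ : j ≠ l) (h₂ : j ≠ q) (h₃ : j ≠ s)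
    (h₄ : l ≠ q) (h₅ : l ≠ s) (h₆ : q ≠ s) :
    (X (p, q) * X (p, s) : S k n) • toQuot k n (row i j l) =
      (X (i, j) * X (i, l) : S k n) • toQuot k n (row p q s) ∧
    (X (q, p) * X (s, p) : S k n) • toQuot k n (col j l i) =
      (X (j, i) * X (l, i) : S k n) • toQuot k n (col q s p) := by
  obtain ⟨hn, π, hπ⟩ := exists_perm_castLE (injective_quadruple h₁ h₂ h₃ h₄ h₅ h₆)
  obtain ⟨σ, hσ0, hσ1⟩ := exists_perm_pair
    ((Fin.castLE_injective hn).ne (show (0 : Fin 4) ≠ 1 by decide)) h₀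
  have hπ0 := hπ 0
  have hπ1 := hπ 1
  have hπ2 := hπ 2
  have hπ3 := hπ 3
  have hx : rhoQ (Fin.castLE hn) ∈ linearRelations k n ∪ quadraticRelations k n :=
    Or.inr ⟨hn, rfl⟩
  have h₁ := toQuot_permute hx σ π
  have h₂ := toQuot_permute_transpose hx π σ
  simp only [rhoQ, permute_sub, permute_smul, transpose_sub, transpose_smul,
    permute_row, permute_col, transpose_row, rename_X, Prod.map_apply, map_mul,
    Prod.swap_prod_mk, hσ0, hσ1, hπ0, hπ1, hπ2, hπ3, map_sub, map_smul,
    Matrix.cons_val] at h₁ h₂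
  exact ⟨sub_eq_zero.1 h₁, sub_eq_zero.1 h₂⟩

/-- The system of relations formed by the classes of the formal generators. -/
def quotSystem (k : Type*) [Field k] (n : ℕ) :
    RelSystem (Fin n) (S k n) (F k n ⧸ orbitSpan k n) where
  x i j := X (i, j)
  row i j l := toQuot k n (row i j l)
  col i m j := toQuot k n (col i m j)
  rect i m j l := toQuot k n (rect i m j l)
  row_comm i j l := by rw [PermSyzygy.row_comm]
  col_comm i j l := by rw [PermSyzygy.col_comm]
  row_self i j := by rw [PermSyzygy.row_self, PermSyzygy.col_self]
  rect_swap_row i m j l := by rw [PermSyzygy.rect_swap_row, map_neg]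
  rect_swap_col i m j l := by rw [PermSyzygy.rect_swap_col, map_neg]
  rect_self_row i j l := by rw [PermSyzygy.rect_self_row, map_zero]
  rect_self_col i m j := by rw [PermSyzygy.rect_self_col, map_zero]
  sq_row h := (quot_sq_row h).1
  sq_col h := (quot_sq_row h).2
  row_row h₁ h₂ h₃ := (quot_row_row h₁ h₂ h₃).1
  col_col h₁ h₂ h₃ := (quot_row_row h₁ h₂ h₃).2
  row_col := quot_row_col
  sq_rect_row h₁ h₂ := (quot_sq_rect h₁ h₂).1
  sq_rect_col h₁ h₂ := (quot_sq_rect h₂ h₁).2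
  row_rect h₁ h₂ h₃ h₄ := (quot_row_rect h₁ h₂ h₃ h₄).1
  col_rect h₁ h₂ h₃ h₄ := (quot_row_rect h₂ h₁ h₃ h₄).2
  rect_rect_row := quot_rect_rect
  -- The column form needs no transposed `rhoS`: it is the row form with the pairs `(m, l)` and `(p,
  -- q)` interchanged, solved for the other term.
  rect_rect_col {i m p j l q} h₁ h₂ h₃ h₄ h₅ h₆ := by
    have h := quot_rect_rect (k := k) h₂ h₁ h₃.symm h₅ h₄ h₆.symm
    rw [PermSyzygy.rect_swap_col p m j q, PermSyzygy.rect_swap_row m i l q, map_neg, map_neg] at h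
    linear_combination (norm := module) -h
  koszul_row h₀ h₁ h₂ h₃ h₄ h₅ h₆ := (quot_koszul h₀ h₁ h₂ h₃ h₄ h₅ h₆).1
  koszul_col h₀ h₁ h₂ h₃ h₄ h₅ h₆ := (quot_koszul h₀ h₁ h₂ h₃ h₄ h₅ h₆).2

end Quotient

/-! ### Potentials on injective functions -/

section Potential

variable {α β : Type*} [DecidableEq α]

theorem comp_swap_comp_swap (g : α → β) {a b c : α} (h₁ : b ≠ a) (h₂ : b ≠ c) :
    (g ∘ Equiv.swap a c) ∘ Equiv.swap b c = (g ∘ Equiv.swap a b) ∘ Equiv.swap a c := by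
  have h : Equiv.swap a c * Equiv.swap b c = Equiv.swap a b * Equiv.swap a c := by
    rw [Equiv.mul_swap_eq_swap_mul, Equiv.swap_apply_right, Equiv.swap_apply_of_ne_of_ne h₁ h₂,
      Equiv.swap_comm b a]
  exact congrArg (fun σ : Equiv.Perm α => g ∘ σ) h

theorem comp_swap_conj (g : α → β) {a b c : α} (h₁ : b ≠ a) (h₂ : b ≠ c) :
    ((g ∘ Equiv.swap c a) ∘ Equiv.swap c b) ∘ Equiv.swap c a = g ∘ Equiv.swap a b := by
  rw [Equiv.swap_comm c b, Equiv.swap_comm c a, comp_swap_comp_swap g h₁ h₂]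
  ext t
  simp

theorem image_comp_swap [DecidableEq β] {A : Finset α} {a b : α} (ha : a ∈ A) (hb : b ∈ A) (g : α → β) :
    A.image (g ∘ Equiv.swap a b) = A.image g := by
  rw [← Finset.image_image]
  congr 1
  ext t
  simp only [Finset.mem_image]
  constructor
  · rintro ⟨s, hs, rfl⟩
    rw [Equiv.swap_apply_def]; split_ifs <;> assumption
  · intro ht
    refine ⟨Equiv.swap a b t, ?_, Equiv.swap_apply_self _ _ _⟩
    rw [Equiv.swap_apply_def]; split_ifs <;> assumption

theorem injOn_comp_swap {A : Finset α} {a b : α} (ha : a ∈ A) (hb : b ∈ A) {g : α → β}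
    (hg : Set.InjOn g A) : Set.InjOn (g ∘ Equiv.swap a b) A := by
  refine hg.comp (Equiv.injective _).injOn fun t ht => ?_
  rw [Equiv.swap_apply_def]; split_ifs <;> assumption

/-- A function on transpositions satisfying the three-term relation is a difference. -/
theorem exists_potential {M : Type*} [LinearOrder β] [AddCommGroup M] (f : (α → β) → α → α → M) (I : Finset α)
    (hsymm : ∀ g a b, f g a b = f g b a)
    (hanti : ∀ g a b, a ≠ b → f (g ∘ Equiv.swap a b) a b = -f g a b)
    (htri : ∀ g, ∀ a ∈ I, ∀ b ∈ I, ∀ c ∈ I, a ≠ b → a ≠ c → b ≠ c →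
      f g a b = f g a c + f (g ∘ Equiv.swap a c) b c +
        f ((g ∘ Equiv.swap a c) ∘ Equiv.swap b c) a c) :
    ∀ A ⊆ I, ∃ P : (α → β) → M, ∀ g, Set.InjOn g A → ∀ a ∈ A, ∀ b ∈ A, a ≠ b →
      P g - P (g ∘ Equiv.swap a b) = f g a b := by
  intro A
  induction A using Finset.induction_on with
  | empty => exact fun _ => ⟨0, by simp⟩
  | insert z A hz ih =>
    intro hAI
    obtain ⟨P, hP⟩ := ih ((Finset.subset_insert z A).trans hAI)
    have hne : ∀ g : α → β, ((insert z A).image g).Nonempty := fun g =>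
      (Finset.insert_nonempty z A).image g
    -- The least value taken on `insert z A` is unchanged by swaps, so its position `c g` singles
    -- out canonical representatives: those with the least value at `z`.
    have hex : ∀ g : α → β, ∃ c ∈ insert z A, g c = ((insert z A).image g).min' (hne g) :=
      fun g => Finset.mem_image.1 (Finset.min'_mem _ (hne g))
    choose c hcA hc using hex
    have hmin : ∀ {T T' : Finset β}, T = T' → ∀ (h : T.Nonempty) (h' : T'.Nonempty),
        T.min' h = T'.min' h' := by
      rintro T _ rfl _ _; rfl
    have hcswap : ∀ g : α → β, Set.InjOn g ↑(insert z A) → ∀ a ∈ insert z A, ∀ b ∈ insert z A,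
        c (g ∘ Equiv.swap a b) = Equiv.swap a b (c g) := by
      intro g hg a ha b hb
      have hg' := injOn_comp_swap ha hb hg
      apply hg' (hcA _)
      · rw [Finset.mem_coe, Equiv.swap_apply_def]
        split_ifs
        exacts [hb, ha, hcA _]
      · rw [hc (g ∘ Equiv.swap a b), Function.comp_apply, Equiv.swap_apply_self, hc g]
        exact hmin (image_comp_swap ha hb g) _ _
    -- Bring the least value to `z` by one swap, pay for it with `f`, and use the old potential
    -- there.
    let P' : (α → β) → M := fun g =>
      if c g = z then P g else f g z (c g) + P (g ∘ Equiv.swap z (c g))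
    have hzI : z ∈ I := hAI (Finset.mem_insert_self z A)
    -- Swaps with `z` come first. The three-term relation enters only when the least value sits
    -- neither at `z` nor at `b`; its third element is then `c g`.
    have star : ∀ g, Set.InjOn g ↑(insert z A) → ∀ b ∈ A,
        P' g - P' (g ∘ Equiv.swap z b) = f g z b := by
      intro g hg b hb
      have hzb : z ≠ b := fun h => hz (h ▸ hb)
      have hc' := hcswap g hg z (Finset.mem_insert_self z A) b (Finset.mem_insert_of_mem hb)
      have hgg : (g ∘ Equiv.swap z b) ∘ Equiv.swap z b = g := by
        ext t; simp
      by_cases h₁ : c g = z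
      · rw [h₁, Equiv.swap_apply_left] at hc'
        simp only [P', h₁, hc', if_true, if_neg hzb.symm, hgg, hanti g z b hzb]
        abel
      by_cases h₂ : c g = b
      · rw [h₂, Equiv.swap_apply_right] at hc'
        simp only [P', h₂, hc', if_true, if_neg hzb.symm]
        abel
      rw [Equiv.swap_apply_of_ne_of_ne h₁ h₂] at hc'
      simp only [P', hc', if_neg h₁]
      have hcgA : c g ∈ A := Finset.mem_of_mem_insert_of_ne (hcA g) h₁
      have hinj : Set.InjOn (g ∘ Equiv.swap z (c g)) A :=
        (injOn_comp_swap (Finset.mem_insert_self z A) (hcA g) hg).mono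
          (Finset.coe_subset.2 (Finset.subset_insert z A))
      have h := hP _ hinj b hb (c g) hcgA (Ne.symm h₂)
      have hperm : (g ∘ Equiv.swap z b) ∘ Equiv.swap z (c g) =
          (g ∘ Equiv.swap z (c g)) ∘ Equiv.swap b (c g) :=
        (comp_swap_comp_swap g hzb.symm (Ne.symm h₂)).symm
      have ht := htri g z hzI b (hAI (Finset.mem_insert_of_mem hb)) (c g)
        (hAI (hcA g)) hzb (Ne.symm h₁) (Ne.symm h₂)
      rw [← hperm, hanti _ _ _ (Ne.symm h₁)] at ht
      rw [← hperm] at h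
      rw [ht, ← h]
      abel
    refine ⟨P', fun g hg a ha b hb hab => ?_⟩
    rcases Finset.mem_insert.1 ha with rfl | ha'
    · exact star g hg b (Finset.mem_of_mem_insert_of_ne hb hab.symm)
    rcases Finset.mem_insert.1 hb with rfl | hb'
    · rw [hsymm, Equiv.swap_comm]
      exact star g hg a ha'
    have haz : a ≠ z := fun h => hz (h ▸ ha')
    have hbz : b ≠ z := fun h => hz (h ▸ hb')
    have hzA := Finset.mem_insert_self z A
    have s₁ := star g hg a ha'
    have hg₁ := injOn_comp_swap hzA ha hg
    have s₂ := star _ hg₁ b hb'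
    have s₃ := star _ (injOn_comp_swap hzA hb hg₁) a ha'
    -- A swap inside `A` is a product of three swaps with `z`, and the three-term relation says that
    -- `f` adds up accordingly.
    have hperm : (((g ∘ Equiv.swap z a) ∘ Equiv.swap z b) ∘ Equiv.swap z a) =
        g ∘ Equiv.swap a b := comp_swap_conj g hab.symm hbz
    rw [hperm] at s₃
    have ht := htri g a (hAI ha) b (hAI hb) z hzI hab haz hbz
    rw [Equiv.swap_comm a z, Equiv.swap_comm b z, hsymm _ a z, hsymm _ b z, hsymm _ a z] at ht
    rw [ht, ← s₁, ← s₂, ← s₃]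
    abel

/-- A function invariant under transpositions of `A` only depends on the image of `A`. -/
theorem eq_of_swap_invariant {γ : Type*} [DecidableEq β] (h : (α → β) → γ) (A : Finset α)
    (hinv : ∀ g, Set.InjOn g A → ∀ a ∈ A, ∀ b ∈ A, h (g ∘ Equiv.swap a b) = h g) :
    ∀ B ⊆ A, ∀ g g' : α → β, Set.InjOn g A → Set.InjOn g' A → B.image g = B.image g' →
      (∀ a ∉ B, g a = g' a) → h g = h g' := by
  intro B
  induction B using Finset.induction_on with
  | empty =>
    intro _ g g' _ _ _ hgg'
    rw [funext fun a => hgg' a (Finset.notMem_empty a)]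
  | insert z B hz ih =>
    intro hBA g g' hg hg' himg hoff
    obtain ⟨c, hcB, hc⟩ : ∃ c ∈ insert z B, g c = g' z :=
      Finset.mem_image.1 (himg ▸ Finset.mem_image_of_mem g' (Finset.mem_insert_self z B))
    have hzB := Finset.mem_insert_self z B
    rw [← hinv g hg z (hBA hzB) c (hBA hcB)]
    have hg'' := injOn_comp_swap (hBA hzB) (hBA hcB) hg
    -- After one swap the two functions agree at `z`, so the place where they may differ shrinks to
    -- `B`.
    refine ih ((Finset.subset_insert z B).trans hBA) _ _ hg'' hg' ?_ ?_
    · have himg' := (image_comp_swap hzB hcB g).trans himg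
      have hz' : (g ∘ Equiv.swap z c) z = g' z := by simp [hc]
      rw [Finset.image_insert, Finset.image_insert, hz'] at himg'
      have n₁ : g' z ∉ B.image (g ∘ Equiv.swap z c) := by
        rw [← hz']
        intro hmem
        obtain ⟨t, ht, hte⟩ := Finset.mem_image.1 hmem
        have := hg'' (hBA (Finset.mem_insert_of_mem ht)) (hBA hzB) hte
        exact hz (this ▸ ht)
      have n₂ : g' z ∉ B.image g' := by
        intro hmem
        obtain ⟨t, ht, hte⟩ := Finset.mem_image.1 hmem
        have := hg' (hBA (Finset.mem_insert_of_mem ht)) (hBA hzB) hte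
        exact hz (this ▸ ht)
      rw [← Finset.erase_insert n₁, himg', Finset.erase_insert n₂]
    · intro a ha
      by_cases haz : a = z
      · subst haz; simp [hc]
      · have haB : a ∉ insert z B := by simp [haz, ha]
        have hac : a ≠ c := fun h => haB (h ▸ hcB)
        rw [Function.comp_apply, Equiv.swap_apply_of_ne_of_ne haz hac, hoff a haB]

end Potential

/-! ### Exponents of placements and of monomials with two cells in conflict -/

section Placement

variable {n : ℕ}

/-- The exponent with a single `1` at each cell `(i, g i)`, `i ∈ I`. -/
def placement (I : Finset (Fin n)) (g : Fin n → Fin n) : Fin n × Fin n →₀ ℕ :=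
  ∑ i ∈ I, Finsupp.single (i, g i) 1

theorem placement_apply (I : Finset (Fin n)) (g : Fin n → Fin n) (i j : Fin n) :
    placement I g (i, j) = if i ∈ I ∧ g i = j then 1 else 0 := by
  simp only [placement, Finsupp.finsetSum_apply, Finsupp.single_apply, Prod.mk.injEq]
  by_cases h : i ∈ I
  · rw [Finset.sum_eq_single_of_mem i h fun m _ hm => by simp [hm]]
    simp [h]
  · rw [Finset.sum_eq_zero fun m hm => if_neg (by rintro ⟨rfl, -⟩; exact h hm)]
    simp [h]

theorem placement_congr {I : Finset (Fin n)} {g g' : Fin n → Fin n} (h : ∀ i ∈ I, g i = g' i) :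
    placement I g = placement I g' :=
  Finset.sum_congr rfl fun i hi => by rw [h i hi]

theorem placement_erase {I : Finset (Fin n)} {i : Fin n} (hi : i ∈ I) (g : Fin n → Fin n) :
    placement I g = Finsupp.single (i, g i) 1 + placement (I.erase i) g :=
  (Finset.add_sum_erase I _ hi).symm

theorem placement_ne_zero {I : Finset (Fin n)} {g : Fin n → Fin n} {i j : Fin n}
    (h : placement I g (i, j) ≠ 0) : i ∈ I ∧ g i = j := by
  rw [placement_apply] at h
  by_contra h'
  exact h (if_neg h')

/-- Two cells in a common row or column occur in the exponent `s`. -/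
def Bad (s : Fin n × Fin n →₀ ℕ) : Prop :=
  ∃ a b u, RelSystem.Conflict a b ∧ s = Finsupp.single a 1 + Finsupp.single b 1 + u

theorem exists_eq_single_add {τ : Type*} {s : τ →₀ ℕ} {a : τ} (h : s a ≠ 0) :
    ∃ u, s = Finsupp.single a 1 + u := by
  refine ⟨s - Finsupp.single a 1, (add_tsub_cancel_of_le ?_).symm⟩
  rw [Finsupp.single_le_iff]
  omega

/-- Unique factorization for monomials: two different variables dividing the same monomial divide it
jointly. -/
theorem exists_of_single_add_eq {τ : Type*} {a b : τ} {u v : τ →₀ ℕ} (hab : a ≠ b)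
    (h : Finsupp.single a 1 + u = Finsupp.single b 1 + v) :
    ∃ w, u = Finsupp.single b 1 + w ∧ v = Finsupp.single a 1 + w := by
  have hb : u b ≠ 0 := by
    have := DFunLike.congr_fun h b
    simp [hab] at this
    omega
  obtain ⟨w, rfl⟩ := exists_eq_single_add hb
  refine ⟨w, rfl, ?_⟩
  rw [add_left_comm] at h
  exact (add_left_cancel h).symm

theorem not_bad_placement {I : Finset (Fin n)} {g : Fin n → Fin n} (hg : Set.InjOn g I) :
    ¬ Bad (placement I g) := by
  rintro ⟨⟨i, j⟩, ⟨m, l⟩, u, hc, h⟩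
  have h₁ := DFunLike.congr_fun h (i, j)
  have h₂ := DFunLike.congr_fun h (m, l)
  simp only [Finsupp.add_apply, Finsupp.single_eq_same] at h₁ h₂
  obtain ⟨hi, rfl⟩ := placement_ne_zero (I := I) (g := g) (i := i) (j := j) (by omega)
  obtain ⟨hm, rfl⟩ := placement_ne_zero (I := I) (g := g) (i := m) (j := l) (by omega)
  have him : i = m := hc.elim id fun h => hg hi hm h
  subst him
  rw [placement_apply, Finsupp.single_eq_same] at h₁
  simp only [hi, true_and, if_true] at h₁
  omega

theorem exists_placement_of_not_bad {s : Fin n × Fin n →₀ ℕ} (hs : ¬ Bad s) :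
    ∃ (I : Finset (Fin n)) (g : Fin n → Fin n), Set.InjOn g I ∧ (∀ i ∉ I, g i = i) ∧ s = placement I g := by
  classical
  have hne : ∀ a b, a ≠ b → s a ≠ 0 → s b ≠ 0 → ¬ RelSystem.Conflict a b := by
    intro a b hab ha hb hc
    obtain ⟨u, rfl⟩ := exists_eq_single_add ha
    have hb' : u b ≠ 0 := by
      simpa [Finsupp.single_apply, hab] using hb
    obtain ⟨v, rfl⟩ := exists_eq_single_add hb'
    exact hs ⟨a, b, v, hc, (add_assoc _ _ _).symm⟩
  have hle : ∀ a, s a ≠ 0 → s a = 1 := by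
    intro a ha
    obtain ⟨u, rfl⟩ := exists_eq_single_add ha
    by_contra h
    have hb' : u a ≠ 0 := by
      intro h0
      simp [h0] at h
    obtain ⟨v, rfl⟩ := exists_eq_single_add hb'
    exact hs ⟨a, a, v, Or.inl rfl, (add_assoc _ _ _).symm⟩
  -- The value `i` on empty rows is a normalization: it makes `g` recoverable from the exponent, as
  -- `placement_inj` requires.
  let g : Fin n → Fin n := fun i => if h : ∃ j, s (i, j) ≠ 0 then h.choose else i
  have hg : ∀ i, (∃ j, s (i, j) ≠ 0) → s (i, g i) ≠ 0 := by
    intro i h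
    simp only [g, dif_pos h]
    exact h.choose_spec
  refine ⟨Finset.univ.filter fun i => ∃ j, s (i, j) ≠ 0, g, ?_, ?_, ?_⟩
  · intro i hi m hm him
    by_contra hne'
    have hi' := hg i (by simpa using hi)
    have hm' := hg m (by simpa using hm)
    exact hne (i, g i) (m, g m) (fun h => hne' (congrArg Prod.fst h)) hi' hm' (Or.inr him)
  · intro i hi
    exact dif_neg (by simpa using hi)
  · ext ⟨i, j⟩
    rw [placement_apply]
    split_ifs with h
    · rw [← h.2]
      exact hle _ (hg i (by simpa using h.1))
    · by_contra h0
      have hex : ∃ j, s (i, j) ≠ 0 := ⟨j, h0⟩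
      have hgj : g i ≠ j := fun h' => h ⟨by simpa using hex, h'⟩
      exact hne (i, g i) (i, j) (fun h' => hgj (congrArg Prod.snd h')) (hg i hex) h0 (Or.inl rfl)

theorem placement_inj {I I' : Finset (Fin n)} {g g' : Fin n → Fin n}
    (hg : ∀ i ∉ I, g i = i) (hg' : ∀ i ∉ I', g' i = i) (h : placement I g = placement I' g') :
    I = I' ∧ g = g' := by
  have key : ∀ {I I' : Finset (Fin n)} {g g' : Fin n → Fin n}, placement I g = placement I' g' →
      ∀ i ∈ I, i ∈ I' ∧ g' i = g i := by
    intro I I' g g' h i hi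
    apply placement_ne_zero
    rw [← h, placement_apply]
    simp [hi]
  have hI : I = I' := Finset.ext fun i => ⟨fun hi => (key h i hi).1, fun hi => (key h.symm i hi).1⟩
  refine ⟨hI, funext fun i => ?_⟩
  by_cases hi : i ∈ I
  · exact (key h i hi).2.symm
  · rw [hg i hi, hg' i (hI ▸ hi)]

theorem placement_comp_swap {I : Finset (Fin n)} {i m : Fin n} (hi : i ∈ I) (hm : m ∈ I)
    (him : i ≠ m) (g : Fin n → Fin n) :
    placement I g = Finsupp.single (i, g i) 1 + Finsupp.single (m, g m) 1 +
        placement ((I.erase i).erase m) g ∧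
      placement I (g ∘ Equiv.swap i m) = Finsupp.single (i, g m) 1 + Finsupp.single (m, g i) 1 +
        placement ((I.erase i).erase m) g := by
  have hm' : m ∈ I.erase i := Finset.mem_erase.2 ⟨him.symm, hm⟩
  constructor
  · rw [placement_erase hi, placement_erase hm', add_assoc]
  · rw [placement_erase hi, placement_erase hm', add_assoc]
    simp only [Function.comp_apply, Equiv.swap_apply_left, Equiv.swap_apply_right]
    congr 2
    refine placement_congr fun t ht => ?_
    simp only [Finset.mem_erase] at ht
    rw [Function.comp_apply, Equiv.swap_apply_of_ne_of_ne ht.2.1 ht.1]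

end Placement

/-! ### A section of the presentation map modulo the orbit span -/

section Value

variable {k : Type*} [Field k] {n : ℕ}

/-- The contribution of exchanging the columns of rows `a` and `b` in a placement. -/
def edge (k : Type*) [Field k] (I : Finset (Fin n)) (g : Fin n → Fin n) (a b : Fin n) :
    F k n ⧸ orbitSpan k n :=
  (monomial (placement ((I.erase a).erase b) g) 1 : S k n) • (quotSystem k n).rect a b (g a) (g b)

theorem quotSystem_y (a : Fin n × Fin n) : (quotSystem k n).y a = X a := rfl

theorem quotSystem_x (i j : Fin n) : (quotSystem k n).x i j = X (i, j) := rfl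

theorem monomial_single_one_add {τ : Type*} (a : τ) (u : τ →₀ ℕ) :
    (monomial (Finsupp.single a 1 + u) 1 : MvPolynomial τ k) = X a * monomial u 1 := by
  rw [monomial_single_add, pow_one]

theorem edge_symm (I : Finset (Fin n)) (g : Fin n → Fin n) (a b : Fin n) :
    edge k I g a b = edge k I g b a := by
  rw [edge, edge, Finset.erase_right_comm, RelSystem.rect_swap_row, RelSystem.rect_swap_col,
    neg_neg]

theorem edge_anti (I : Finset (Fin n)) (g : Fin n → Fin n) (a b : Fin n) :
    edge k I (g ∘ Equiv.swap a b) a b = -edge k I g a b := by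
  have h : placement ((I.erase a).erase b) (g ∘ Equiv.swap a b) =
      placement ((I.erase a).erase b) g := by
    refine placement_congr fun t ht => ?_
    simp only [Finset.mem_erase] at ht
    rw [Function.comp_apply, Equiv.swap_apply_of_ne_of_ne ht.2.1 ht.1]
  rw [edge, edge, ← smul_neg, ← RelSystem.rect_swap_col, h]
  simp only [Function.comp_apply, Equiv.swap_apply_left, Equiv.swap_apply_right]

/-- The rooks outside rows `a, b, c` give a common factor in all four terms. What remains is
`smul_rect_rect`, whose three coefficients are the rooks left in place by the successive exchanges.
-/
theorem edge_tri (I : Finset (Fin n)) (g : Fin n → Fin n) {a b c : Fin n} (ha : a ∈ I)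
    (hb : b ∈ I) (hc : c ∈ I) (hab : a ≠ b) (hac : a ≠ c) (hbc : b ≠ c) :
    edge k I g a b = edge k I g a c + edge k I (g ∘ Equiv.swap a c) b c +
      edge k I ((g ∘ Equiv.swap a c) ∘ Equiv.swap b c) a c := by
  have hc' : c ∈ (I.erase a).erase b := by simp [hc, hac.symm, hbc.symm]
  have hb' : b ∈ (I.erase a).erase c := by simp [hb, hab.symm, hbc]
  have ha' : a ∈ (I.erase b).erase c := by simp [ha, hab, hac]
  have e₁ : ((I.erase a).erase c).erase b = ((I.erase a).erase b).erase c :=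
    Finset.erase_right_comm
  have e₂ : ((I.erase b).erase c).erase a = ((I.erase a).erase b).erase c := by
    rw [Finset.erase_right_comm, Finset.erase_right_comm (a := b) (b := a)]
  have p₁ : placement (((I.erase a).erase b).erase c) (g ∘ Equiv.swap a c) =
      placement (((I.erase a).erase b).erase c) g := by
    refine placement_congr fun t ht => ?_
    simp only [Finset.mem_erase] at ht
    rw [Function.comp_apply, Equiv.swap_apply_of_ne_of_ne ht.2.2.1 ht.1]
  have p₂ : placement (((I.erase a).erase b).erase c) ((g ∘ Equiv.swap a c) ∘ Equiv.swap b c) =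
      placement (((I.erase a).erase b).erase c) g := by
    rw [← p₁]
    refine placement_congr fun t ht => ?_
    simp only [Finset.mem_erase] at ht
    rw [Function.comp_apply, Equiv.swap_apply_of_ne_of_ne ht.2.1 ht.1]
  rw [edge, edge, edge, edge, placement_erase hc', placement_erase hb', placement_erase ha',
    placement_erase hb', e₁, e₂, p₁, p₂]
  simp only [monomial_single_one_add, Function.comp_apply, Equiv.swap_apply_left,
    Equiv.swap_apply_right, Equiv.swap_apply_of_ne_of_ne hab.symm hbc,
    Equiv.swap_apply_of_ne_of_ne hab hac]
  have h := (quotSystem k n).smul_rect_rect a b c (g a) (g b) (g c)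
  simp only [quotSystem_x] at h
  linear_combination (norm := module)
    (monomial (placement (((I.erase a).erase b).erase c) g) 1 : S k n) • h

theorem exists_edge_potential (I : Finset (Fin n)) :
    ∃ P : (Fin n → Fin n) → F k n ⧸ orbitSpan k n, ∀ g, Set.InjOn g I → ∀ a ∈ I, ∀ b ∈ I, a ≠ b →
      P g - P (g ∘ Equiv.swap a b) = edge k I g a b :=
  exists_potential (edge k I) I (edge_symm I) (fun g a b _ => edge_anti I g a b)
    (fun g _ ha _ hb _ hc => edge_tri I g ha hb hc) I subset_rfl

/-- A potential for the exchanges of columns in placements on `I`. -/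
def potential (k : Type*) [Field k] (I : Finset (Fin n)) :
    (Fin n → Fin n) → F k n ⧸ orbitSpan k n :=
  (exists_edge_potential I).choose

/-! ### Values of monomials and their compatibility with the generators -/

theorem conf_smul_eq {a b c e : Fin n × Fin n} {u v : Fin n × Fin n →₀ ℕ}
    (hab : RelSystem.Conflict a b) (hce : RelSystem.Conflict c e)
    (h : Finsupp.single a 1 + Finsupp.single b 1 + u =
      Finsupp.single c 1 + Finsupp.single e 1 + v) :
    (monomial u 1 : S k n) • (quotSystem k n).conf a b =
      (monomial v 1 : S k n) • (quotSystem k n).conf c e := by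
  have share : ∀ {a b e : Fin n × Fin n}, RelSystem.Conflict a b → RelSystem.Conflict a e →
      Finsupp.single b 1 + u = Finsupp.single e 1 + v →
      (monomial u 1 : S k n) • (quotSystem k n).conf a b =
        (monomial v 1 : S k n) • (quotSystem k n).conf a e := by
    intro a b e hb he h
    by_cases hbe : b = e
    · subst hbe
      rw [add_left_cancel h]
    obtain ⟨w, rfl, rfl⟩ := exists_of_single_add_eq hbe h
    rw [monomial_single_one_add, monomial_single_one_add]
    have h := (quotSystem k n).smul_conf_conf hb he
    simp only [quotSystem_y] at h
    linear_combination (norm := module) (monomial w 1 : S k n) • h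
  rw [add_assoc, add_assoc] at h
  by_cases h₁ : a = c
  · subst h₁
    exact share hab hce (add_left_cancel h)
  by_cases h₂ : a = e
  · subst h₂
    rw [(quotSystem k n).conf_comm hce]
    rw [add_left_comm (Finsupp.single c 1)] at h
    exact share hab hce.symm (add_left_cancel h)
  obtain ⟨w, h₃, h₄⟩ := exists_of_single_add_eq h₁ h
  by_cases h₅ : b = c
  · subst h₅
    rw [(quotSystem k n).conf_comm hab]
    refine share hab.symm hce ?_
    rw [add_left_cancel h₃, h₄]
  by_cases h₆ : b = e
  · subst h₆
    rw [(quotSystem k n).conf_comm hab, (quotSystem k n).conf_comm hce]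
    rw [add_left_comm (Finsupp.single c 1), add_left_comm (Finsupp.single a 1)] at h
    exact share hab.symm hce.symm (add_left_cancel h)
  -- The two pairs have no cell in common, so the monomial is divisible by both products and the
  -- Koszul relation applies.
  obtain ⟨w', rfl, rfl⟩ := exists_of_single_add_eq h₅ h₃
  obtain ⟨w, rfl, h₇⟩ := exists_of_single_add_eq (Ne.symm h₂) h₄
  obtain ⟨w', rfl, rfl⟩ := exists_of_single_add_eq h₆ h₇
  simp only [monomial_single_one_add]
  have h := (quotSystem k n).koszul_conf_conf hab hce
  simp only [quotSystem_y] at h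
  linear_combination (norm := module) (monomial w' 1 : S k n) • h

open Classical in
/-- For a monomial with two cells in conflict, the class of a multiple of the corresponding
generator; for a placement, its potential. -/
def value (k : Type*) [Field k] (s : Fin n × Fin n →₀ ℕ) : F k n ⧸ orbitSpan k n :=
  if h : Bad s then
    (monomial h.choose_spec.choose_spec.choose 1 : S k n) •
      (quotSystem k n).conf h.choose h.choose_spec.choose
  else
    potential k (exists_placement_of_not_bad h).choose
      (exists_placement_of_not_bad h).choose_spec.choose

theorem value_conflict {a b : Fin n × Fin n} (h : RelSystem.Conflict a b)
    (u : Fin n × Fin n →₀ ℕ) :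
    value k (Finsupp.single a 1 + Finsupp.single b 1 + u) =
      (monomial u 1 : S k n) • (quotSystem k n).conf a b := by
  have hbad : Bad (Finsupp.single a 1 + Finsupp.single b 1 + u) := ⟨a, b, u, h, rfl⟩
  rw [value, dif_pos hbad]
  have hs := hbad.choose_spec.choose_spec.choose_spec
  exact conf_smul_eq hs.1 h hs.2.symm

theorem value_placement {I : Finset (Fin n)} {g : Fin n → Fin n} (hg : Set.InjOn g I)
    (hg' : ∀ i ∉ I, g i = i) :
    value k (placement I g) = potential k I g := by
  have hbad := not_bad_placement hg
  rw [value, dif_neg hbad]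
  have hs := (exists_placement_of_not_bad hbad).choose_spec.choose_spec
  obtain ⟨h₁, h₂⟩ := placement_inj hg' hs.2.1 hs.2.2
  have key : ∀ {I'} {g' : Fin n → Fin n}, I = I' → g = g' →
      potential k I' g' = potential k I g := by
    rintro _ _ rfl rfl; rfl
  exact key h₁ h₂

/-- A cell `c` in the row or column of `(i, j)` also conflicts with `(i, l)` or `(m, j)`
respectively. Hence both monomials have a conflict involving `c`, and the identity is a linear
relation between a permanent and products. -/
theorem value_sub_value_of_conflict {i j : Fin n} {c : Fin n × Fin n}
    (hc : RelSystem.Conflict (i, j) c) (m l : Fin n) (v : Fin n × Fin n →₀ ℕ) :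
    value k (Finsupp.single (i, j) 1 + Finsupp.single (m, l) 1 + (Finsupp.single c 1 + v)) -
      value k (Finsupp.single (i, l) 1 + Finsupp.single (m, j) 1 + (Finsupp.single c 1 + v)) =
    (monomial (Finsupp.single c 1 + v) 1 : S k n) • (quotSystem k n).rect i m j l := by
  have e : ∀ a b : Fin n × Fin n, Finsupp.single a 1 + Finsupp.single b 1 +
      (Finsupp.single c 1 + v) = Finsupp.single a 1 + Finsupp.single c 1 +
        (Finsupp.single b 1 + v) := fun a b => by abel
  obtain ⟨p, q⟩ := c
  rcases hc with hc | hc <;> dsimp only at hc <;> subst hc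
  · have hc : ∀ t, RelSystem.Conflict (i, t) (i, q) := fun _ => Or.inl rfl
    rw [e, e, value_conflict (hc j), value_conflict (hc l)]
    simp only [monomial_single_one_add, RelSystem.conf_row]
    have h := (quotSystem k n).smul_row_rect i m j l q
    simp only [quotSystem_x] at h
    linear_combination (norm := module) -(monomial v 1 : S k n) • h
  · have hc : ∀ t, RelSystem.Conflict (t, j) (p, j) := fun _ => Or.inr rfl
    rw [e, add_comm (Finsupp.single (i, l) 1), e, value_conflict (hc i), value_conflict (hc m)]
    simp only [monomial_single_one_add, RelSystem.conf_col]
    have h := (quotSystem k n).smul_col_rect i m j l p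
    simp only [quotSystem_x] at h
    linear_combination (norm := module) -(monomial v 1 : S k n) • h

theorem value_sub_value (i m j l : Fin n) (u : Fin n × Fin n →₀ ℕ) :
    value k (Finsupp.single (i, j) 1 + Finsupp.single (m, l) 1 + u) -
      value k (Finsupp.single (i, l) 1 + Finsupp.single (m, j) 1 + u) =
    (monomial u 1 : S k n) • (quotSystem k n).rect i m j l := by
  by_cases him : i = m
  · subst him
    rw [RelSystem.rect_self_row, add_comm (Finsupp.single (i, j) 1), sub_self, smul_zero]
  by_cases hjl : j = l
  · subst hjl
    rw [RelSystem.rect_self_col, sub_self, smul_zero]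
  have conf₁ : ∀ {c w}, RelSystem.Conflict (i, j) c → u = Finsupp.single c 1 + w →
      value k (Finsupp.single (i, j) 1 + Finsupp.single (m, l) 1 + u) -
        value k (Finsupp.single (i, l) 1 + Finsupp.single (m, j) 1 + u) =
      (monomial u 1 : S k n) • (quotSystem k n).rect i m j l := by
    rintro c w hc rfl
    exact value_sub_value_of_conflict hc m l w
  have conf₂ : ∀ {c w}, RelSystem.Conflict (m, l) c → u = Finsupp.single c 1 + w →
      value k (Finsupp.single (i, j) 1 + Finsupp.single (m, l) 1 + u) -
        value k (Finsupp.single (i, l) 1 + Finsupp.single (m, j) 1 + u) =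
      (monomial u 1 : S k n) • (quotSystem k n).rect i m j l := by
    rintro c w hc rfl
    have h := value_sub_value_of_conflict (k := k) hc i j w
    rw [RelSystem.rect_swap_row, RelSystem.rect_swap_col, neg_neg] at h
    rw [← h, add_comm (Finsupp.single (i, j) 1), add_comm (Finsupp.single (i, l) 1)]
  by_cases hbad : Bad (Finsupp.single (i, j) 1 + Finsupp.single (m, l) 1 + u)
  · obtain ⟨a, b, v, hab, h⟩ := hbad
    have hnc : ¬ RelSystem.Conflict (i, j) (m, l) := fun h => h.elim him hjl
    have share : ∀ {a b}, RelSystem.Conflict a b →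
        Finsupp.single (i, j) 1 + Finsupp.single (m, l) 1 + u =
          Finsupp.single a 1 + Finsupp.single b 1 + v → a = (i, j) ∨ a = (m, l) →
        value k (Finsupp.single (i, j) 1 + Finsupp.single (m, l) 1 + u) -
          value k (Finsupp.single (i, l) 1 + Finsupp.single (m, j) 1 + u) =
        (monomial u 1 : S k n) • (quotSystem k n).rect i m j l := by
      rintro a b hab h (rfl | rfl)
      · rw [add_assoc, add_assoc] at h
        have hb : (m, l) ≠ b := by rintro rfl; exact hnc hab
        obtain ⟨w, h₁, -⟩ := exists_of_single_add_eq hb (add_left_cancel h)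
        exact conf₁ hab h₁
      · rw [add_assoc, add_assoc, add_left_comm] at h
        have hb : (i, j) ≠ b := by rintro rfl; exact hnc hab.symm
        obtain ⟨w, h₁, -⟩ := exists_of_single_add_eq hb (add_left_cancel h)
        exact conf₂ hab h₁
    by_cases ha : a = (i, j) ∨ a = (m, l)
    · exact share hab h ha
    by_cases hb : b = (i, j) ∨ b = (m, l)
    · rw [add_comm (Finsupp.single a 1)] at h
      exact share hab.symm h hb
    -- The conflict now lies entirely in the cofactor `u`, so the Koszul relation between a product
    -- and a permanent finishes.
    push Not at ha hb
    rw [add_assoc, add_assoc] at h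
    obtain ⟨w, h₁, h₂⟩ := exists_of_single_add_eq ha.1.symm h
    obtain ⟨w', h₃, rfl⟩ := exists_of_single_add_eq ha.2.symm h₁
    obtain ⟨w, h₄, h₅⟩ := exists_of_single_add_eq hb.1 h₂
    obtain ⟨w'', h₆, h₇⟩ := exists_of_single_add_eq hb.2.symm h₅
    have hu : u = Finsupp.single a 1 + Finsupp.single b 1 + w'' := by
      rw [h₃, h₆, add_assoc]
    have e : ∀ c e : Fin n × Fin n, Finsupp.single c 1 + Finsupp.single e 1 + u =
        Finsupp.single a 1 + Finsupp.single b 1 +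
          (Finsupp.single c 1 + (Finsupp.single e 1 + w'')) := fun c e => by rw [hu]; abel
    rw [e, e, value_conflict hab, value_conflict hab, hu, add_assoc]
    simp only [monomial_single_one_add]
    have h := (quotSystem k n).koszul_conf_rect hab i m j l
    simp only [quotSystem_y] at h
    linear_combination (norm := module) -(monomial w'' 1 : S k n) • h
  · obtain ⟨I, g, hg, hg', hs⟩ := exists_placement_of_not_bad hbad
    obtain ⟨hi, rfl⟩ := placement_ne_zero (I := I) (g := g) (i := i) (j := j) (by simp [← hs])
    obtain ⟨hm, rfl⟩ := placement_ne_zero (I := I) (g := g) (i := m) (j := l) (by simp [← hs])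
    obtain ⟨h₁, h₂⟩ := placement_comp_swap hi hm him g
    have hu : u = placement ((I.erase i).erase m) g := add_left_cancel (hs.trans h₁)
    -- The swapped function must keep the normalization off `I` for `value_placement` to use the
    -- same potential on it.
    have hg'' : ∀ t ∉ I, (g ∘ Equiv.swap i m) t = t := by
      intro t ht
      rw [Function.comp_apply, Equiv.swap_apply_of_ne_of_ne, hg' t ht]
      · rintro rfl; exact ht hi
      · rintro rfl; exact ht hm
    rw [hs, hu, ← h₂, value_placement hg hg', value_placement (injOn_comp_swap hi hm hg) hg'']
    exact (exists_edge_potential (k := k) I).choose_spec g hg i hi m hm him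

/-- The `k`-linear extension of `value`. -/
def valueMap (k : Type*) [Field k] (n : ℕ) : S k n →ₗ[k] F k n ⧸ orbitSpan k n :=
  (basisMonomials (Fin n × Fin n) k).constr k fun s => value k s

theorem valueMap_monomial (s : Fin n × Fin n →₀ ℕ) :
    valueMap k n (monomial s 1) = value k s := by
  have h := (basisMonomials (Fin n × Fin n) k).constr_basis k (fun s => value k s) s
  rwa [coe_basisMonomials] at h

theorem valueMap_d (x : F k n) : valueMap k n (d (permGen k n) x) = toQuot k n x := by
  induction x using Finsupp.induction_linear with
  | zero => simp
  | add x y hx hy => rw [map_add, map_add, map_add, hx, hy]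
  | single g p =>
    induction p using MvPolynomial.induction_on' with
    | add p q hp hq => rw [Finsupp.single_add, map_add, map_add, map_add, hp, hq]
    | monomial u a =>
      have h₀ : (Finsupp.single g (monomial u a) : F k n) =
          a • ((monomial u 1 : S k n) • Finsupp.single g 1) := by
        simp [smul_monomial]
      have hk : ∀ x : F k n, d (permGen k n) (a • x) = a • d (permGen k n) x := fun x => by
        rw [← algebraMap_smul (S k n) a x, map_smul, algebraMap_smul]
      have hk' : ∀ x : F k n, toQuot k n (a • x) = a • toQuot k n x := fun x => rfl
      rw [h₀, hk, LinearMap.map_smul (valueMap k n), hk']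
      congr 1
      rw [map_smul (d _), map_smul (toQuot k n)]
      have hX : ∀ b c : Fin n × Fin n, (monomial u 1 : S k n) • (X b * X c : S k n) =
          monomial (Finsupp.single b 1 + Finsupp.single c 1 + u) 1 := fun b c => by
        rw [add_assoc, monomial_single_one_add, monomial_single_one_add, smul_eq_mul]; ring
      cases g with
      | sq i j =>
        have h : (Finsupp.single (.sq i j) 1 : F k n) = row i j j := by rw [row_self]; rfl
        rw [h, d_row, hX, valueMap_monomial,
          value_conflict (show RelSystem.Conflict (i, j) (i, j) from Or.inl rfl), RelSystem.conf_row]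
        rfl
      | row i j l h =>
        rw [← row_of_lt h, d_row, hX, valueMap_monomial,
          value_conflict (show RelSystem.Conflict (i, j) (i, l) from Or.inl rfl), RelSystem.conf_row]
        rfl
      | col i m j h =>
        rw [← col_of_lt h, d_col, hX, valueMap_monomial,
          value_conflict (show RelSystem.Conflict (i, j) (m, j) from Or.inr rfl), RelSystem.conf_col]
        rfl
      | rect i m j l h h' =>
        rw [← rect_of_lt h h', d_rect, smul_sub, hX, hX, map_sub, valueMap_monomial,
          valueMap_monomial, value_sub_value]
        rfl

theorem ker_d_permGen : LinearMap.ker (d (permGen k n)) = orbitSpan k n := by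
  refine le_antisymm (fun x hx => ?_) orbitSpan_le_ker
  rw [← toQuot_eq_zero_iff, ← valueMap_d, LinearMap.mem_ker.1 hx, map_zero]

end Value

/-! ### The image of the presentation map -/

section Image

variable {k : Type*} [Field k] {n : ℕ}

theorem permPoly_eq_sum :
    permPoly k n = ∑ σ : Equiv.Perm (Fin n), monomial (placement Finset.univ σ) 1 := by
  -- `Matrix.permanent` multiplies the entries `(σ i, i)`, while a placement uses the cells `(i, σ
  -- i)`; hence the passage to inverses.
  rw [permPoly, Matrix.permanent, ← Equiv.sum_comp (Equiv.inv _)]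
  refine Finset.sum_congr rfl fun σ _ => ?_
  rw [placement, monomial_sum_one, ← Equiv.prod_comp σ]
  refine Finset.prod_congr rfl fun i _ => ?_
  simp [Matrix.mvPolynomialX_apply, X]

theorem placement_univ_injective {σ τ : Equiv.Perm (Fin n)}
    (h : placement Finset.univ σ = placement Finset.univ τ) : σ = τ :=
  Equiv.coe_fn_injective (placement_inj (by simp) (by simp) h).2

open Classical in
theorem coeff_permPoly (u : Fin n × Fin n →₀ ℕ) :
    coeff u (permPoly k n) =
      if ∃ σ : Equiv.Perm (Fin n), u = placement Finset.univ σ then 1 else 0 := by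
  rw [permPoly_eq_sum, coeff_sum]
  simp only [coeff_monomial]
  split_ifs with h
  · obtain ⟨σ, rfl⟩ := h
    rw [Finset.sum_eq_single_of_mem σ (Finset.mem_univ _), if_pos rfl]
    intro τ _ hτ
    exact if_neg fun h => hτ (placement_univ_injective h)
  · exact Finset.sum_eq_zero fun σ _ => if_neg fun h' => h ⟨σ, h'.symm⟩

theorem coeff_contract {τ : Type*} (f g : MvPolynomial τ k) (t : τ →₀ ℕ) :
    coeff t (contract f g) = ∑ s ∈ g.support, coeff s g * coeff (s + t) f := by
  conv_lhs => rw [g.as_sum]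
  rw [map_sum, coeff_sum]
  simp [contract_monomial, coeff_divMonomial]

theorem coeff_contract_monomial {τ : Type*} (f : MvPolynomial τ k) (s t : τ →₀ ℕ) :
    coeff t (contract f (monomial s 1)) = coeff (s + t) f := by
  rw [contract_monomial, one_smul, coeff_divMonomial]

theorem X_mul_X_eq_monomial {τ : Type*} (a b : τ) :
    (X a * X b : MvPolynomial τ k) =
      monomial (Finsupp.single a 1 + Finsupp.single b 1) 1 := by
  simp [X, monomial_mul]

/-! ### The generators annihilate the permanent -/

theorem X_mul_X_mem_apolarIdeal {a b : Fin n × Fin n} (h : RelSystem.Conflict a b) :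
    (X a * X b : S k n) ∈ apolarIdeal (permPoly k n) := by
  change contract _ _ = 0
  ext t
  rw [X_mul_X_eq_monomial, coeff_contract_monomial, coeff_permPoly, if_neg, coeff_zero]
  rintro ⟨σ, hσ⟩
  exact not_bad_placement σ.injective.injOn ⟨a, b, t, h, hσ.symm⟩

theorem exists_perm_placement_of_swap {i m j l : Fin n} (him : i ≠ m) {t : Fin n × Fin n →₀ ℕ}
    (h : ∃ σ : Equiv.Perm (Fin n), Finsupp.single (i, j) 1 + Finsupp.single (m, l) 1 + t =
      placement Finset.univ σ) :
    ∃ σ : Equiv.Perm (Fin n), Finsupp.single (i, l) 1 + Finsupp.single (m, j) 1 + t =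
      placement Finset.univ σ := by
  obtain ⟨σ, hσ⟩ := h
  obtain ⟨-, rfl⟩ := placement_ne_zero (I := Finset.univ) (g := σ) (i := i) (j := j)
    (by simp [← hσ])
  obtain ⟨-, rfl⟩ := placement_ne_zero (I := Finset.univ) (g := σ) (i := m) (j := l)
    (by simp [← hσ])
  obtain ⟨h₁, h₂⟩ := placement_comp_swap (Finset.mem_univ i) (Finset.mem_univ m) him σ
  refine ⟨σ * Equiv.swap i m, ?_⟩
  rw [add_left_cancel (hσ.trans h₁), Equiv.Perm.coe_mul, h₂]

theorem rect_mem_apolarIdeal {i m : Fin n} (him : i ≠ m) (j l : Fin n) :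
    (X (i, j) * X (m, l) - X (i, l) * X (m, j) : S k n) ∈ apolarIdeal (permPoly k n) := by
  change contract _ _ = 0
  ext t
  rw [map_sub, coeff_sub, X_mul_X_eq_monomial, X_mul_X_eq_monomial, coeff_contract_monomial,
    coeff_contract_monomial, coeff_permPoly, coeff_permPoly, coeff_zero, sub_eq_zero]
  congr 1
  exact propext ⟨exists_perm_placement_of_swap him, exists_perm_placement_of_swap him⟩

theorem permGen_mem_apolarIdeal (g : Gen n) : permGen k n g ∈ apolarIdeal (permPoly k n) := by
  cases g with
  | sq i j => rw [permGen, pow_two]; exact X_mul_X_mem_apolarIdeal (Or.inl rfl)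
  | row i j l h => exact X_mul_X_mem_apolarIdeal (Or.inl rfl)
  | col i m j h => exact X_mul_X_mem_apolarIdeal (Or.inr rfl)
  | rect i m j l h h' => exact rect_mem_apolarIdeal h.ne j l

theorem range_d_le_apolarIdeal :
    LinearMap.range (d (permGen k n)) ≤ apolarIdeal (permPoly k n) := by
  rintro _ ⟨x, rfl⟩
  rw [d, Finsupp.linearCombination_apply]
  exact Submodule.sum_mem _ fun g _ => Submodule.smul_mem _ _ (permGen_mem_apolarIdeal g)

/-- The class of a monomial modulo the image of the presentation map. -/
def monomialClass (k : Type*) [Field k] (s : Fin n × Fin n →₀ ℕ) :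
    S k n ⧸ LinearMap.range (d (permGen k n)) :=
  (LinearMap.range (d (permGen k n))).mkQ (monomial s 1)

theorem monomialClass_of_bad {s : Fin n × Fin n →₀ ℕ} (hs : Bad s) : monomialClass k s = 0 := by
  obtain ⟨⟨i, j⟩, ⟨m, l⟩, u, h, rfl⟩ := hs
  refine (Submodule.Quotient.mk_eq_zero _).2 ?_
  rw [add_assoc, monomial_single_one_add, monomial_single_one_add, ← mul_assoc, mul_comm,
    ← smul_eq_mul]
  refine Submodule.smul_mem _ _ ?_
  rcases h with h | h <;> dsimp only at h <;> subst h
  · exact ⟨row i j l, d_row _ _ _⟩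
  · exact ⟨col i m j, d_col _ _ _⟩

theorem monomialClass_comp_swap {I : Finset (Fin n)} (g : Fin n → Fin n) {a b : Fin n}
    (ha : a ∈ I) (hb : b ∈ I) :
    monomialClass k (placement I (g ∘ Equiv.swap a b)) = monomialClass k (placement I g) := by
  by_cases hab : a = b
  · subst hab; simp
  obtain ⟨h₁, h₂⟩ := placement_comp_swap ha hb hab g
  refine (Submodule.Quotient.eq _).2 ?_
  refine ⟨(monomial (placement ((I.erase a).erase b) g) 1 : S k n) • rect a b (g b) (g a), ?_⟩
  rw [map_smul, d_rect, h₁, h₂, add_assoc, add_assoc]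
  simp only [monomial_single_one_add, smul_eq_mul]
  ring

theorem monomialClass_eq_of_image_eq {I : Finset (Fin n)} {g g' : Fin n → Fin n}
    (hg : Set.InjOn g I) (hg' : Set.InjOn g' I) (hoff : ∀ i ∉ I, g i = g' i)
    (h : I.image g = I.image g') :
    monomialClass k (placement I g) = monomialClass k (placement I g') :=
  eq_of_swap_invariant (fun g => monomialClass k (placement I g)) I
    (fun g _ _ ha _ hb => monomialClass_comp_swap g ha hb) I subset_rfl g g' hg hg' h hoff

/-- The sets of rows and of columns met by an exponent. -/
def shape (s : Fin n × Fin n →₀ ℕ) : Finset (Fin n) × Finset (Fin n) :=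
  (s.support.image Prod.fst, s.support.image Prod.snd)

theorem mem_support_placement {I : Finset (Fin n)} {g : Fin n → Fin n} {a : Fin n × Fin n} :
    a ∈ (placement I g).support ↔ a.1 ∈ I ∧ g a.1 = a.2 := by
  obtain ⟨i, j⟩ := a
  rw [Finsupp.mem_support_iff, placement_apply]
  simp

theorem shape_placement (I : Finset (Fin n)) (g : Fin n → Fin n) :
    shape (placement I g) = (I, I.image g) := by
  refine Prod.ext ?_ ?_
  · ext i
    simp only [shape, Finset.mem_image, mem_support_placement]
    exact ⟨fun ⟨a, ha, h⟩ => h ▸ ha.1, fun hi => ⟨(i, g i), ⟨hi, rfl⟩, rfl⟩⟩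
  · ext j
    simp only [shape, Finset.mem_image, mem_support_placement]
    exact ⟨fun ⟨a, ha, h⟩ => ⟨a.1, ha.1, ha.2.trans h⟩,
      fun ⟨i, hi, h⟩ => ⟨(i, g i), ⟨hi, rfl⟩, h⟩⟩

theorem placement_add_compl (I : Finset (Fin n)) (g : Fin n → Fin n) :
    placement I g + placement Iᶜ g = placement Finset.univ g :=
  Finset.sum_add_sum_compl I _

/-- The rooks of `σ` outside `I` serve as a probe: they complete a monomial to a full permutation
exactly when it is a placement using the remaining rows and columns. -/
theorem exists_perm_iff_shape_eq (I : Finset (Fin n)) (σ : Equiv.Perm (Fin n))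
    (s : Fin n × Fin n →₀ ℕ) :
    (∃ τ : Equiv.Perm (Fin n), s + placement Iᶜ σ = placement Finset.univ τ) ↔
      ¬ Bad s ∧ shape s = (I, I.image σ) := by
  constructor
  · rintro ⟨τ, h⟩
    have hoff : ∀ i ∈ Iᶜ, σ i = τ i := by
      intro i hi
      have h' : placement Finset.univ τ (i, σ i) ≠ 0 := by
        rw [← h, Finsupp.add_apply, placement_apply Iᶜ]
        simp [Finset.mem_compl.1 hi]
      exact (placement_ne_zero h').2.symm
    have hs : s = placement I τ := by
      rw [← placement_add_compl I, placement_congr hoff] at h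
      exact add_right_cancel h
    subst hs
    refine ⟨not_bad_placement τ.injective.injOn, ?_⟩
    rw [shape_placement, Prod.mk.injEq]
    -- Both images have as many elements as `I`, so one inclusion is enough.
    refine ⟨rfl, Finset.eq_of_subset_of_card_le ?_ ?_⟩
    · intro y hy
      obtain ⟨i, hi, rfl⟩ := Finset.mem_image.1 hy
      refine Finset.mem_image.2 ⟨σ.symm (τ i), ?_, by simp⟩
      by_contra hn
      have h' := hoff _ (Finset.mem_compl.2 hn)
      rw [Equiv.apply_symm_apply] at h'
      rw [← τ.injective h'] at hn
      exact hn hi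
    · rw [Finset.card_image_of_injective _ σ.injective, Finset.card_image_of_injective _ τ.injective]
  · rintro ⟨hs, hshape⟩
    obtain ⟨I', g, hg, -, rfl⟩ := exists_placement_of_not_bad hs
    rw [shape_placement, Prod.mk.injEq] at hshape
    obtain ⟨rfl, himg⟩ := hshape
    -- The permutation is glued from `g` on `I'` and `σ` elsewhere; the two parts do not collide
    -- because `g` and `σ` have the same image on `I'`.
    have hinj : Function.Injective fun i => if i ∈ I' then g i else σ i := by
      have mixed : ∀ i ∈ I', ∀ m ∉ I', g i ≠ σ m := by
        intro i hi m hm h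
        obtain ⟨t, ht, hte⟩ := Finset.mem_image.1 (himg ▸ Finset.mem_image_of_mem g hi)
        exact hm (σ.injective (hte.trans h) ▸ ht)
      intro i m him
      dsimp only at him
      split_ifs at him with hi hm hm
      · exact hg hi hm him
      · exact absurd him (mixed i hi m hm)
      · exact absurd him.symm (mixed m hm i hi)
      · exact σ.injective him
    refine ⟨Equiv.ofBijective _ (Finite.injective_iff_bijective.1 hinj), ?_⟩
    rw [← placement_add_compl I']
    congr 1
    · exact placement_congr fun i hi => by simp [hi]
    · exact placement_congr fun i hi => by simp [Finset.mem_compl.1 hi]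

theorem monomialClass_eq_of_shape_eq {s s' : Fin n × Fin n →₀ ℕ} (hs : ¬ Bad s) (hs' : ¬ Bad s')
    (h : shape s = shape s') : monomialClass k s = monomialClass k s' := by
  obtain ⟨I, g, hg, hoff, rfl⟩ := exists_placement_of_not_bad hs
  obtain ⟨I', g', hg', hoff', rfl⟩ := exists_placement_of_not_bad hs'
  rw [shape_placement, shape_placement, Prod.mk.injEq] at h
  obtain ⟨rfl, h⟩ := h
  exact monomialClass_eq_of_image_eq hg hg' (fun i hi => (hoff i hi).trans (hoff' i hi).symm) h

open Classical in
theorem sum_coeff_eq_zero {f : S k n} (hf : f ∈ apolarIdeal (permPoly k n))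
    {s : Fin n × Fin n →₀ ℕ} (hs : ¬ Bad s) :
    ∑ t ∈ f.support with ¬ Bad t ∧ shape t = shape s, coeff t f = 0 := by
  obtain ⟨I, g, hg, hoff, rfl⟩ := exists_placement_of_not_bad hs
  -- Extend the partial placement to a permutation; the coefficient of `contract (permPoly k n) f`
  -- at its complementary part is the required sum.
  obtain ⟨σ', hσ⟩ := Finset.exists_equiv_extend_of_card_eq (t := Finset.univ) (by simp)
    (Finset.subset_univ (I.image g)) hg
  let σ : Equiv.Perm (Fin n) := σ'.trans (Equiv.subtypeUnivEquiv Finset.mem_univ)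
  have hσg : ∀ i ∈ I, σ i = g i := hσ
  have h : coeff (placement Iᶜ σ) (contract (permPoly k n) f) = 0 := by
    rw [show contract (permPoly k n) f = 0 from hf, coeff_zero]
  rw [coeff_contract] at h
  rw [shape_placement, ← Finset.image_congr (s := I) (f := σ) (g := g) (fun i hi => hσg i hi)]
  simp only [coeff_permPoly, exists_perm_iff_shape_eq, mul_ite, mul_one, mul_zero] at h
  rwa [Finset.sum_filter]

theorem range_d_permGen :
    LinearMap.range (d (permGen k n)) = apolarIdeal (permPoly k n) := by
  classical
  refine le_antisymm range_d_le_apolarIdeal fun f hf => ?_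
  rw [← Submodule.Quotient.mk_eq_zero, ← Submodule.mkQ_apply, f.as_sum, map_sum]
  have h₀ : ∀ s : Fin n × Fin n →₀ ℕ,
      (LinearMap.range (d (permGen k n))).mkQ (monomial s (coeff s f)) =
        (C (coeff s f) : S k n) • monomialClass k s := by
    intro s
    rw [monomialClass, ← map_smul, smul_eq_mul, C_mul_monomial, mul_one]
  simp only [h₀]
  -- Conflicting monomials drop out, and the others are grouped by `shape`: each group is one class
  -- times a coefficient sum, which vanishes by apolarity.
  rw [← Finset.sum_filter_add_sum_filter_not f.support Bad, Finset.sum_eq_zero, zero_add,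
    ← Finset.sum_fiberwise_of_maps_to (g := shape) fun s hs => Finset.mem_image_of_mem shape hs]
  · refine Finset.sum_eq_zero fun κ hκ => ?_
    obtain ⟨s, hs, rfl⟩ := Finset.mem_image.1 hκ
    have hs' := (Finset.mem_filter.1 hs).2
    rw [Finset.filter_filter]
    have h : ∀ t ∈ f.support.filter fun t => ¬ Bad t ∧ shape t = shape s,
        (C (coeff t f) : S k n) • monomialClass k t =
          (C (coeff t f) : S k n) • monomialClass k s := fun t ht => by
      have ht' := (Finset.mem_filter.1 ht).2
      rw [monomialClass_eq_of_shape_eq ht'.1 hs' ht'.2]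
    rw [Finset.sum_congr rfl h, ← Finset.sum_smul, ← map_sum, sum_coeff_eq_zero hf hs', map_zero,
      zero_smul]
  · intro s hs
    rw [monomialClass_of_bad (Finset.mem_filter.1 hs).2, smul_zero]

end Image

/-! ### Characteristic two -/

section CharTwo

variable {k : Type*} [Field k] {n : ℕ}

theorem detGen_eq_permGen [CharP k 2] : detGen k n = permGen k n := by
  funext g
  cases g <;> simp [detGen, permGen, CharTwo.sub_eq_add]

theorem detPoly_eq_permPoly [CharP k 2] : detPoly k n = permPoly k n := by
  rw [detPoly, permPoly, Matrix.det_apply, Matrix.permanent]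
  refine Finset.sum_congr rfl fun σ _ => ?_
  rcases Int.units_eq_one_or (Equiv.Perm.sign σ) with h | h <;> simp [h, CharTwo.neg_eq]

end CharTwo

end

end PermSyzygy

theorem mainTheorem2 (k : Type*) [Field k] (n : ℕ) (hn : 1 ≤ n) :
    (LinearMap.range (PermSyzygy.d (PermSyzygy.permGen k n))
        = PermSyzygy.apolarIdeal (PermSyzygy.permPoly k n) ∧
      LinearMap.ker (PermSyzygy.d (PermSyzygy.permGen k n)) = PermSyzygy.orbitSpan k n) ∧
    (CharP k 2 →
      LinearMap.range (PermSyzygy.d (PermSyzygy.detGen k n))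
          = PermSyzygy.apolarIdeal (PermSyzygy.detPoly k n) ∧
        LinearMap.ker (PermSyzygy.d (PermSyzygy.detGen k n)) = PermSyzygy.orbitSpan k n) := by
  refine ⟨⟨PermSyzygy.range_d_permGen, PermSyzygy.ker_d_permGen⟩, fun _ => ?_⟩
  rw [PermSyzygy.detGen_eq_permGen, PermSyzygy.detPoly_eq_permPoly]
  exact ⟨PermSyzygy.range_d_permGen, PermSyzygy.ker_d_permGen⟩
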